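/- Let $V\in C^\infty(\mathbb R;\mathbb R)$ with $V=V_{\rm per}+V_{\rm def}$, where $V_{\rm per}(x+1)=V_{\rm per}(x)$ for all $x$ and $V_{\rm def}(x)=0$ for $|x|>\rho$ ($\rho\ge 0$); no parity symmetry is assumed. Suppose $H=-\partial_x^2+V$ has a bound state $0\ne\Phi\in L^2(\mathbb R)$, $H\Phi=E\Phi$ with $E>0$, normalized so that $\Phi(0)=1$ if $\Phi(0)\neq0$ and $\Phi'(0)=1$ if $\Phi(0)=0$. For $\vec\zeta=(w,z)\in\mathbb C^2$ let $u_{\vec\zeta},v_{\vec\zeta}$ be the solutions of $-f''+Vf=zf$ with $$\big(u_{\vec\zeta}(0),u_{\vec\zeta}'(0)\big)=(1,w),\qquad \big(v_{\vec\zeta}(0),v_{\vec\zeta}'(0)\big)=\Big(\tfrac{-w}{1+w^2},\tfrac{1}{1+w^2}\Big)\qquad\text{if }\Phi(0)\ne0,$$ $$\big(u_{\vec\zeta}(0),u_{\vec\zeta}'(0)\big)=(-w,1),\qquad \big(v_{\vec\zeta}(0),v_{\vec\zeta}'(0)\big)=\Big(\tfrac{-1}{1+w^2},\tfrac{-w}{1+w^2}\Big)\qquad\text{if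 }\Phi(0)=0.$$ Put $\vec\eta=(w_0,E)$, where $w_0=\Phi'(0)$ if $\Phi(0)\neq 0$ and $w_0=0$ if $\Phi(0)=0$. Let $\sqrt{\cdot}$ be the principal square root, and for $M>0$ let $$\Theta^\pm(\vec\zeta)=u_{\vec\zeta}'(\pm M)\mp i\sqrt z\,u_{\vec\zeta}(\pm M),\qquad \vec\Theta=(\Theta^+,\Theta^-).$$ Write $A_\pm=v_{\vec\eta}'(\pm M)\mp i\sqrt E\,v_{\vec\eta}(\pm M)$ and $B_\pm=u_{\vec\eta}'(\pm M)\mp i\sqrt E\,u_{\vec\eta}(\pm M)$. Then the larger in modulus of the characteristic (Floquet) multipliers of $-y''+V_{\rm per}y=Ey$ has modulus $e^{\kappa}$ with $\kappa>0$, and for every $0<k\le\kappa$ there are $M_0>\rho$ and $C>0$ such that for all $M\ge M_0$ the following holds. The quantity $A_+A_-\int_{-M}^{M}u_{\vec\eta}^2\,dy$ is nonzero. The function $\vec\Theta$ has exactly one root $\vec\zeta^*=(w^*,z^*)$ in the ball $\{\vec\zeta\in\mathbb C^2:|\vec\zeta-\vec\eta|\le M^{-2}e^{-kM}\}$. The number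 $z^*$ is a resonance of $H_{\rm trunc}=-\partial_x^2+V\mathbf 1_{[-M,M]}$, that is, $\operatorname{Re}z^*>0$, $\operatorname{Im}z^*<0$, and $H_{\rm trunc}\psi=z^*\psi$ has a nonzero $C^1$ solution equal to a multiple of $e^{i\sqrt{z^*}x}$ for $x\ge M$ and to a multiple of $e^{-i\sqrt{z^*}x}$ for $x\le -M$. Finally $$w^*=w_0-\frac{A_-B_+\int_{-M}^0u_{\vec\eta}^2\,dy+A_+B_-\int_0^Mu_{\vec\eta}^2\,dy}{A_+A_-\int_{-M}^Mu_{\vec\eta}^2\,dy}+R_w,\qquad z^*=E-\frac{A_+B_--A_-B_+}{A_+A_-\int_{-M}^Mu_{\vec\eta}^2\,dy}+R_z,$$ where $|R_w|,|R_z|\le C\,M e^{-4\kappa M}$; and if $k<\kappa$, also $|R_w|,|R_z|\le C e^{-4kM}$, that is, the remainders are $O(e^{-4kM})$. -/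

import Mathlib

open MeasureTheory
open scoped ContDiff

noncomputable section

/-- `f` is a (classical) solution on the whole line of `(D_x² + V(x) - z) f = 0`, where
`D_x² = -d²/dx²`, i.e. of `f'' = (V - z) f`. -/
def IsSchrodingerSolution (V : ℝ → ℝ) (z : ℂ) (f : ℝ → ℂ) : Prop :=
  Differentiable ℝ f ∧ ∀ x : ℝ, HasDerivAt (deriv f) (((V x : ℂ) - z) * f x) x

/-- `Φ` is a bound state of `H = D_x² + V` with eigenvalue `E`: a nonzero square-integrable
function with `H Φ = E Φ`. -/
def IsBoundState (V : ℝ → ℝ) (E : ℝ) (Φ : ℝ → ℂ) : Prop :=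
  Φ ≠ 0 ∧ MemLp Φ 2 (volume : Measure ℝ) ∧ IsSchrodingerSolution V (E : ℂ) Φ

/-- `κ > 0` is the logarithm of the modulus of the larger characteristic (Floquet) multiplier of
the `1`-periodic equation `-y'' + Vper y = E y`. The two multipliers have product `1`, so there is
at most one such `κ`. -/
def IsFloquetExponent (Vper : ℝ → ℝ) (E κ : ℝ) : Prop :=
  0 < κ ∧ ∃ (mult : ℂ) (y : ℝ → ℂ), ‖mult‖ = Real.exp κ ∧ y ≠ 0 ∧
    IsSchrodingerSolution Vper (E : ℂ) y ∧ ∀ x : ℝ, y (x + 1) = mult * y x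

/-- The solution `f` of `(D_x² + V(x) - z) f = 0`, `f(0) = a`, `f'(0) = b`
(for continuous `V` it exists and is unique). -/
def ivpSolution (V : ℝ → ℝ) (z a b : ℂ) : ℝ → ℂ :=
  Classical.epsilon fun f : ℝ → ℂ => IsSchrodingerSolution V z f ∧ f 0 = a ∧ deriv f 0 = b

open Classical in
/-- `u_ζ` for `ζ = (w, z)`: the initial data are `(1, w)` when `Φ(0) ≠ 0` and `(-w, 1)` when
`Φ(0) = 0`. -/
def uSol (V : ℝ → ℝ) (Φ : ℝ → ℂ) (ζ : ℂ × ℂ) : ℝ → ℂ :=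
  if Φ 0 ≠ 0 then ivpSolution V ζ.2 1 ζ.1 else ivpSolution V ζ.2 (-ζ.1) 1

open Classical in
/-- `v_ζ` for `ζ = (w, z)`: the initial data are `(-w/(1+w²), 1/(1+w²))` when `Φ(0) ≠ 0` and
`(-1/(1+w²), -w/(1+w²))` when `Φ(0) = 0`. -/
def vSol (V : ℝ → ℝ) (Φ : ℝ → ℂ) (ζ : ℂ × ℂ) : ℝ → ℂ :=
  if Φ 0 ≠ 0 then ivpSolution V ζ.2 (-ζ.1 / (1 + ζ.1 ^ 2)) (1 / (1 + ζ.1 ^ 2))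
  else ivpSolution V ζ.2 (-1 / (1 + ζ.1 ^ 2)) (-ζ.1 / (1 + ζ.1 ^ 2))

open Classical in
/-- `w₀ = Φ'(0)` when `Φ(0) ≠ 0` and `w₀ = 0` when `Φ(0) = 0`. -/
def wZero (Φ : ℝ → ℂ) : ℂ := if Φ 0 ≠ 0 then deriv Φ 0 else 0

/-- `η = (w₀, E)`. -/
def etaVec (Φ : ℝ → ℂ) (E : ℝ) : ℂ × ℂ := (wZero Φ, (E : ℂ))

/-- The principal branch of the square root: `±Im z > 0` implies `±Im √z > 0`. -/
def csqrt (z : ℂ) : ℂ := z ^ (1 / 2 : ℂ)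

/-- `f'(M) - i √z f(M)`. -/
def outPlus (z : ℂ) (f : ℝ → ℂ) (M : ℝ) : ℂ := deriv f M - Complex.I * csqrt z * f M

/-- `f'(-M) + i √z f(-M)`. -/
def outMinus (z : ℂ) (f : ℝ → ℂ) (M : ℝ) : ℂ := deriv f (-M) + Complex.I * csqrt z * f (-M)

/-- `Θ(ζ) = (Θ⁺(ζ), Θ⁻(ζ))`, with `Θ^±(ζ) = u_ζ'(±M) ∓ i √z u_ζ(±M)`, `ζ = (w, z)`. -/
def Theta (V : ℝ → ℝ) (Φ : ℝ → ℂ) (M : ℝ) (ζ : ℂ × ℂ) : ℂ × ℂ :=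
  (outPlus ζ.2 (uSol V Φ ζ) M, outMinus ζ.2 (uSol V Φ ζ) M)

/-- The closed ball `Ω_M` of radius `e^{-kM} / M²` about `η`, for the Euclidean norm of `ℂ²`. -/
def OmegaBall (Φ : ℝ → ℂ) (E k M : ℝ) : Set (ℂ × ℂ) :=
  {ζ | Real.sqrt (‖ζ.1 - (etaVec Φ E).1‖ ^ 2 + ‖ζ.2 - (etaVec Φ E).2‖ ^ 2)
    ≤ 1 / M ^ 2 * Real.exp (-(k * M))}

open Classical in
/-- The truncated potential: `V` on `[-M, M]`, and `0` outside. -/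
def Vtrunc (V : ℝ → ℝ) (M : ℝ) (x : ℝ) : ℝ := if |x| ≤ M then V x else 0

/-- `z` is a resonance of `H_trunc = D_x² + V_trunc`: `Re z > 0`, `Im z < 0`, and
`H_trunc ψ = z ψ` has a nonzero outgoing solution (`C¹` across the jumps of `V_trunc`). -/
def IsResonance (V : ℝ → ℝ) (M : ℝ) (z : ℂ) : Prop :=
  0 < z.re ∧ z.im < 0 ∧ ∃ ψ : ℝ → ℂ, ψ ≠ 0 ∧ ContDiff ℝ 1 ψ ∧
    (∀ x : ℝ, |x| ≠ M → HasDerivAt (deriv ψ) (((Vtrunc V M x : ℂ) - z) * ψ x) x) ∧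
    (∃ c : ℂ, ∀ x : ℝ, M ≤ x → ψ x = c * Complex.exp (Complex.I * csqrt z * x)) ∧
    (∃ c : ℂ, ∀ x : ℝ, x ≤ -M → ψ x = c * Complex.exp (-(Complex.I * csqrt z * x)))

/-- `∫_a^b u_η(y)² dy`. -/
def uSqInt (V : ℝ → ℝ) (Φ : ℝ → ℂ) (E a b : ℝ) : ℂ :=
  ∫ y in a..b, uSol V Φ (etaVec Φ E) y ^ 2

/-- The common denominator of the two correction terms,
`∫_{-M}^M u_η² · (v_η'(M) - i√E v_η(M)) · (v_η'(-M) + i√E v_η(-M))`. -/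
def corrDenom (V : ℝ → ℝ) (Φ : ℝ → ℂ) (E M : ℝ) : ℂ :=
  uSqInt V Φ E (-M) M * outPlus E (vSol V Φ (etaVec Φ E)) M * outMinus E (vSol V Φ (etaVec Φ E)) M

/-- The explicit approximation of `w*`. -/
def wApprox (V : ℝ → ℝ) (Φ : ℝ → ℂ) (E M : ℝ) : ℂ :=
  wZero Φ -
    (uSqInt V Φ E (-M) 0 * outMinus E (vSol V Φ (etaVec Φ E)) M
        * outPlus E (uSol V Φ (etaVec Φ E)) M
      + uSqInt V Φ E 0 M * outPlus E (vSol V Φ (etaVec Φ E)) M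
        * outMinus E (uSol V Φ (etaVec Φ E)) M)
    / corrDenom V Φ E M

/-- The explicit approximation of `z*`. -/
def zApprox (V : ℝ → ℝ) (Φ : ℝ → ℂ) (E M : ℝ) : ℂ :=
  (E : ℂ) -
    (outPlus E (vSol V Φ (etaVec Φ E)) M * outMinus E (uSol V Φ (etaVec Φ E)) M
      - outMinus E (vSol V Φ (etaVec Φ E)) M * outPlus E (uSol V Φ (etaVec Φ E)) M)
    / corrDenom V Φ E M

end

/-! ### Global existence for linear second-order equations -/

/-! The root comes from a Newton argument at η whose linear part is explicit. A square-integrable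
solution forces the periodic equation at energy E to be hyperbolic, with multipliers of modulus
e^{±κ} and κ > 0 (`IsBoundState.exists_floquetExponent`). Hence Φ = u_η decays like e^{-κ|x|} on
both sides, while v_η grows at most like e^{κ|x|} and has unit Wronskian with Φ. The left half-line
is the reflected right one for the potential V(-x), so no parity of V is needed.

With δ = w - w₀, the data of u_ζ at 0 are those of (1 + aδ)Φ + δ v_η for a constant a. Variation of
parameters against (Φ, v_η) gives Θ⁺ ≈ B₊ + A₊(δ - (z - E)I₊) and Θ⁻ ≈ B₋ + A₋(δ + (z - E)I₋), where
I₊, I₋ are the integrals of Φ² over [0, M] and [-M, 0]. Since v_η is real and E > 0, the Wronskian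
identity forces |A±| to be at least a constant times e^{κM}
(`IsDichotomyPair.exp_le_norm_outPlus_v`). After division by A±, Θ is a linear map of determinant I₋
+ I₊, bounded below because Φ is real, plus an error of Lipschitz constant O(M(e^{-2κM} + r)) on a
ball of radius r (`exists_theta_lipschitz`).

A contraction then gives existence and uniqueness (`exists_zero_of_approx_affine`). The explicit
formulas are exactly the first Newton step from η (`approx_eq`), of size O(B±/A±) = O(e^{-2κM}). The
root is therefore that close to η, and reusing the Lipschitz estimate at this much smaller radius
bounds the remainder by O(M e^{-4κM}).

At a root, u_ζ continues by outgoing exponentials across ±M (`exists_outgoing_extension`), and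
conservation of the current fixes the sign of Im z (`im_neg_of_outgoing`). -/

theorem norm_integral_le_of_norm_le_exp_abs {F : Type*} [NormedAddCommGroup F] [NormedSpace ℝ F]
    {f : ℝ → F} {c K : ℝ} (hK : 0 < K) (hc : 0 ≤ c) (hf : ∀ t, ‖f t‖ ≤ c * Real.exp (K * |t|))
    (x : ℝ) : ‖∫ t in (0 : ℝ)..x, f t‖ ≤ c / K * Real.exp (K * |x|) := by
  have key : ∀ (s : ℝ), 0 ≤ s → ∀ g : ℝ → F, (∀ t, ‖g t‖ ≤ c * Real.exp (K * |t|)) →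
      ‖∫ t in (0 : ℝ)..s, g t‖ ≤ c / K * Real.exp (K * s) := by
    intro s hs g hg
    have h1 : ‖∫ t in (0 : ℝ)..s, g t‖ ≤ ∫ t in (0 : ℝ)..s, c * Real.exp (K * t) := by
      refine intervalIntegral.norm_integral_le_of_norm_le hs ?_ ?_
      · refine Filter.Eventually.of_forall fun t ht => ?_
        simpa [abs_of_pos ht.1] using hg t
      · exact Continuous.intervalIntegrable (by fun_prop) _ _
    refine h1.trans ?_
    rw [intervalIntegral.integral_const_mul, intervalIntegral.integral_comp_mul_left _ hK.ne',
      integral_exp]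
    simp only [mul_zero, Real.exp_zero, smul_eq_mul]
    have : c * (K⁻¹ * (Real.exp (K * s) - 1)) = c / K * Real.exp (K * s) - c / K := by
      field_simp
    rw [this]
    have : 0 ≤ c / K := by positivity
    linarith
  rcases le_total 0 x with hx | hx
  · simpa [abs_of_nonneg hx] using key x hx f hf
  · have h := key (-x) (by linarith) (fun t => f (-t)) (fun t => by simpa using hf (-t))
    rw [intervalIntegral.integral_comp_neg, neg_neg, neg_zero, intervalIntegral.integral_symm,
      norm_neg] at h
    simpa [abs_of_nonpos hx] using h

-- Picard iteration converges on the whole line at once in the sup norm weighted by e^{-K|x|}; the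
-- bounded unknown is e^{-K|x|} Y.
open BoundedContinuousFunction in
theorem exists_integral_solution {q : ℝ → ℂ} (hq : Continuous q) {L : ℝ} (hL : 1 ≤ L)
    (hqL : ∀ x, ‖q x‖ ≤ L) (Y₀ : ℂ × ℂ) :
    ∃ Y : ℝ → ℂ × ℂ, Continuous Y ∧
      ∀ x, Y x = Y₀ + ∫ t in (0 : ℝ)..x, ((Y t).2, q t * (Y t).1) := by
  -- Integration against the weight gains 1/K, so this rate makes the map contract by L/K = 1/2.
  set K : ℝ := 2 * L with hKdef
  have hK : 0 < K := by linarith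
  let F : (ℝ →ᵇ ℂ × ℂ) → ℝ → ℂ × ℂ := fun g t =>
    Real.exp (K * |t|) • ((g t).2, q t * (g t).1)
  have hFc : ∀ g, Continuous (F g) := fun g => by
    have := g.continuous
    simp only [F]
    fun_prop
  have hFn : ∀ g : ℝ →ᵇ ℂ × ℂ, ∀ t, ‖F g t‖ ≤ (L * ‖g‖) * Real.exp (K * |t|) := by
    intro g t
    have h0 := g.norm_coe_le_norm t
    have h1 : ‖(g t).1‖ ≤ ‖g‖ := (norm_fst_le _).trans h0
    have h2 : ‖(g t).2‖ ≤ ‖g‖ := (norm_snd_le _).trans h0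
    simp only [F, norm_smul, Real.norm_eq_abs, Real.abs_exp, Prod.norm_def, norm_mul]
    rw [mul_comm]
    refine mul_le_mul_of_nonneg_right (max_le ?_ ?_) (Real.exp_pos _).le
    · nlinarith [norm_nonneg g]
    · exact mul_le_mul (hqL t) h1 (norm_nonneg _) (by linarith)
  have hFi : ∀ g x, ‖Real.exp (-(K * |x|)) • ∫ t in (0 : ℝ)..x, F g t‖ ≤ 1 / 2 * ‖g‖ := by
    intro g x
    have h := norm_integral_le_of_norm_le_exp_abs hK (by positivity) (hFn g) x
    rw [norm_smul, Real.norm_eq_abs, Real.abs_exp]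
    calc _ ≤ Real.exp (-(K * |x|)) * (L * ‖g‖ / K * Real.exp (K * |x|)) := by gcongr
      _ = L * ‖g‖ / K * (Real.exp (-(K * |x|)) * Real.exp (K * |x|)) := by ring
      _ = 1 / 2 * ‖g‖ := by rw [← Real.exp_add]; simp [hKdef]; field_simp
  have hFint : ∀ g a b, IntervalIntegrable (F g) volume a b :=
    fun g a b => (hFc g).intervalIntegrable a b
  have hprim : ∀ g, Continuous fun x => ∫ t in (0 : ℝ)..x, F g t := fun g =>
    intervalIntegral.continuous_primitive (hFint g) 0
  let T : (ℝ →ᵇ ℂ × ℂ) → (ℝ →ᵇ ℂ × ℂ) := fun g =>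
    BoundedContinuousFunction.ofNormedAddCommGroup
      (fun x => Real.exp (-(K * |x|)) • (Y₀ + ∫ t in (0 : ℝ)..x, F g t))
      (by have := hprim g; fun_prop) (‖Y₀‖ + 1 / 2 * ‖g‖) (by
        intro x
        rw [smul_add]
        refine (norm_add_le _ _).trans (add_le_add ?_ (hFi g x))
        rw [norm_smul, Real.norm_eq_abs, Real.abs_exp]
        refine mul_le_of_le_one_left (norm_nonneg _) (Real.exp_le_one_iff.2 ?_)
        have := mul_nonneg hK.le (abs_nonneg x)
        linarith)
  have hsub : ∀ g₁ g₂ t, F (g₁ - g₂) t = F g₁ t - F g₂ t := by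
    intro g₁ g₂ t
    simp only [F, BoundedContinuousFunction.coe_sub, Pi.sub_apply, Prod.fst_sub, Prod.snd_sub]
    rw [← smul_sub]
    congr 1
    ext <;> simp [mul_sub]
  have hT : ContractingWith (1 / 2) T := by
    refine ⟨by norm_num, LipschitzWith.of_dist_le_mul fun g₁ g₂ => ?_⟩
    rw [BoundedContinuousFunction.dist_le (by positivity)]
    intro x
    have h := hFi (g₁ - g₂) x
    have : ∫ t in (0 : ℝ)..x, F (g₁ - g₂) t
        = (∫ t in (0 : ℝ)..x, F g₁ t) - ∫ t in (0 : ℝ)..x, F g₂ t := by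
      rw [← intervalIntegral.integral_sub (hFint _ _ _) (hFint _ _ _)]
      exact intervalIntegral.integral_congr fun t _ => hsub g₁ g₂ t
    rw [this] at h
    rw [dist_eq_norm, dist_eq_norm]
    simp only [T, BoundedContinuousFunction.coe_ofNormedAddCommGroup]
    rw [← smul_sub, add_sub_add_left_eq_sub]
    simpa using h
  obtain ⟨g, hg⟩ : ∃ g, T g = g := ⟨_, hT.fixedPoint_isFixedPt⟩
  refine ⟨fun x => Real.exp (K * |x|) • g x, by have := g.continuous; fun_prop, fun x => ?_⟩
  have hx : Real.exp (-(K * |x|)) • (Y₀ + ∫ t in (0 : ℝ)..x, F g t) = g x :=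
    congrArg (fun h : ℝ →ᵇ ℂ × ℂ => h x) hg
  dsimp only
  rw [← hx, smul_smul, ← Real.exp_add, add_neg_cancel, Real.exp_zero, one_smul]
  congr 1
  refine intervalIntegral.integral_congr fun t _ => ?_
  simp only [F]
  ext <;> simp
  ring

theorem exists_isSchrodingerSolution {V : ℝ → ℝ} (hV : Continuous V) {b : ℝ}
    (hb : ∀ x, |V x| ≤ b) (z a a' : ℂ) :
    ∃ f, IsSchrodingerSolution V z f ∧ f 0 = a ∧ deriv f 0 = a' := by
  have hq : Continuous fun x : ℝ => (V x : ℂ) - z := by fun_prop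
  obtain ⟨Y, hYc, hY⟩ := exists_integral_solution hq (L := b + ‖z‖ + 1)
    (by linarith [(abs_nonneg _).trans (hb 0), norm_nonneg z])
    (fun x => by
      refine (norm_sub_le _ _).trans ?_
      rw [Complex.norm_real, Real.norm_eq_abs]
      linarith [hb x]) (a, a')
  have hd : ∀ x, HasDerivAt Y ((Y x).2, ((V x : ℂ) - z) * (Y x).1) x := by
    intro x
    have hc : Continuous fun t => ((Y t).2, ((V t : ℂ) - z) * (Y t).1) := by fun_prop
    have := (intervalIntegral.integral_hasDerivAt_right (hc.intervalIntegrable 0 x)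
      (hc.stronglyMeasurableAtFilter _ _) hc.continuousAt).const_add (a, a')
    exact this.congr_of_eventuallyEq (Filter.Eventually.of_forall hY)
  have h1 : ∀ x, HasDerivAt (fun x => (Y x).1) (Y x).2 x := fun x => (hd x).fst
  have h2 : ∀ x, HasDerivAt (fun x => (Y x).2) (((V x : ℂ) - z) * (Y x).1) x :=
    fun x => (hd x).snd
  have hder : deriv (fun x => (Y x).1) = fun x => (Y x).2 := funext fun x => (h1 x).deriv
  refine ⟨fun x => (Y x).1, ⟨fun x => (h1 x).differentiableAt, ?_⟩, ?_, ?_⟩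
  · rw [hder]; exact h2
  · simp [hY 0]
  · rw [hder]; simp [hY 0]

/-! ### Wronskians -/

namespace IsSchrodingerSolution

variable {V : ℝ → ℝ} {z : ℂ} {f : ℝ → ℂ}

theorem hasDerivAt (hf : IsSchrodingerSolution V z f) (x : ℝ) : HasDerivAt f (deriv f x) x :=
  (hf.1 x).hasDerivAt

theorem continuous (hf : IsSchrodingerSolution V z f) : Continuous f := hf.1.continuous

theorem continuous_deriv (hf : IsSchrodingerSolution V z f) : Continuous (deriv f) :=
  continuous_iff_continuousAt.2 fun x => (hf.2 x).continuousAt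

theorem of_hasDerivAt {f' : ℝ → ℂ} (h1 : ∀ x, HasDerivAt f (f' x) x)
    (h2 : ∀ x, HasDerivAt f' (((V x : ℂ) - z) * f x) x) :
    IsSchrodingerSolution V z f ∧ deriv f = f' := by
  have h : deriv f = f' := funext fun x => (h1 x).deriv
  exact ⟨⟨fun x => (h1 x).differentiableAt, by rwa [h]⟩, h⟩

theorem linearCombination {g : ℝ → ℂ} (hf : IsSchrodingerSolution V z f)
    (hg : IsSchrodingerSolution V z g) (a b : ℂ) :
    IsSchrodingerSolution V z (fun x => a * f x + b * g x) ∧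
      deriv (fun x => a * f x + b * g x) = fun x => a * deriv f x + b * deriv g x := by
  refine of_hasDerivAt
    (fun x => ((hf.hasDerivAt x).const_mul a).add ((hg.hasDerivAt x).const_mul b)) fun x => ?_
  exact (((hf.2 x).const_mul a).add ((hg.2 x).const_mul b)).congr_deriv (by ring)

theorem comp_neg (hf : IsSchrodingerSolution V z f) :
    IsSchrodingerSolution (fun x => V (-x)) z (fun x => f (-x)) ∧
      deriv (fun x => f (-x)) = fun x => -deriv f (-x) := by
  refine of_hasDerivAt (fun x => ?_) fun x => ?_
  · exact ((hf.hasDerivAt (-x)).scomp x (hasDerivAt_neg x)).congr_deriv (by simp)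
  · exact ((hf.2 (-x)).scomp x (hasDerivAt_neg x)).neg.congr_deriv (by simp)

theorem comp_add_const (hf : IsSchrodingerSolution V z f) {c : ℝ} (hV : ∀ x, V (x + c) = V x) :
    IsSchrodingerSolution V z (fun x => f (x + c)) ∧
      deriv (fun x => f (x + c)) = fun x => deriv f (x + c) := by
  refine of_hasDerivAt (fun x => (hf.hasDerivAt (x + c)).comp_add_const x c) fun x => ?_
  rw [← hV x]
  exact (hf.2 (x + c)).comp_add_const x c

theorem conj {E : ℝ} (hf : IsSchrodingerSolution V (E : ℂ) f) :
    IsSchrodingerSolution V (E : ℂ) (fun x => (starRingEnd ℂ) (f x)) ∧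
      deriv (fun x => (starRingEnd ℂ) (f x)) = fun x => (starRingEnd ℂ) (deriv f x) := by
  refine of_hasDerivAt (fun x => (hf.hasDerivAt x).star) fun x => ?_
  exact (hf.2 x).star.congr_deriv (by simp)

/-- The Wronskian has derivative (z₁ - z₂) f g. This identity underlies both the constancy of
Wronskians and variation of parameters. -/
theorem wronskian_sub {z₁ z₂ : ℂ} {g : ℝ → ℂ} (hf : IsSchrodingerSolution V z₁ f)
    (hg : IsSchrodingerSolution V z₂ g) (x y : ℝ) :
    (f y * deriv g y - deriv f y * g y) - (f x * deriv g x - deriv f x * g x)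
      = (z₁ - z₂) * ∫ t in x..y, f t * g t := by
  rw [← intervalIntegral.integral_const_mul]
  refine (intervalIntegral.integral_eq_sub_of_hasDerivAt
    (f := fun t => f t * deriv g t - deriv f t * g t) (fun t _ => ?_) ?_).symm
  · exact (((hf.hasDerivAt t).mul (hg.2 t)).sub ((hf.2 t).mul (hg.hasDerivAt t))).congr_deriv
      (by ring)
  · have := hf.continuous
    have := hg.continuous
    exact Continuous.intervalIntegrable (by fun_prop) _ _

theorem wronskian_eq {g : ℝ → ℂ} (hf : IsSchrodingerSolution V z f)
    (hg : IsSchrodingerSolution V z g) (x y : ℝ) :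
    f y * deriv g y - deriv f y * g y = f x * deriv g x - deriv f x * g x := by
  have := hf.wronskian_sub hg x y
  rw [sub_self, zero_mul] at this
  exact sub_eq_zero.1 this

/-- Two solutions with unit Wronskian span all solutions. -/
theorem eq_combination {u v : ℝ → ℂ} (hu : IsSchrodingerSolution V z u)
    (hv : IsSchrodingerSolution V z v) (hf : IsSchrodingerSolution V z f)
    (hW : u 0 * deriv v 0 - deriv u 0 * v 0 = 1) (x : ℝ) :
    f x = (f 0 * deriv v 0 - deriv f 0 * v 0) * u x + (u 0 * deriv f 0 - deriv u 0 * f 0) * v x ∧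
    deriv f x = (f 0 * deriv v 0 - deriv f 0 * v 0) * deriv u x
      + (u 0 * deriv f 0 - deriv u 0 * f 0) * deriv v x := by
  have h1 := hf.wronskian_eq hv 0 x
  have h2 := hu.wronskian_eq hf 0 x
  have h3 := hu.wronskian_eq hv 0 x
  rw [hW] at h3
  rw [← h1, ← h2]
  constructor
  · linear_combination (-f x) * h3
  · linear_combination (-deriv f x) * h3

/-- Solutions with the same Cauchy data at `0` agree. -/
theorem eq_of_initial {g : ℝ → ℂ} (hV : Continuous V) {b : ℝ} (hb : ∀ x, |V x| ≤ b)
    (hf : IsSchrodingerSolution V z f) (hg : IsSchrodingerSolution V z g) (h0 : f 0 = g 0)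
    (h1 : deriv f 0 = deriv g 0) : f = g := by
  obtain ⟨u, hu, hu0, hu1⟩ := exists_isSchrodingerSolution hV hb z 1 0
  obtain ⟨v, hv, hv0, hv1⟩ := exists_isSchrodingerSolution hV hb z 0 1
  have hW : u 0 * deriv v 0 - deriv u 0 * v 0 = 1 := by rw [hu0, hu1, hv0, hv1]; ring
  funext x
  rw [(eq_combination hu hv hf hW x).1, (eq_combination hu hv hg hW x).1, h0, h1]

end IsSchrodingerSolution

theorem ivpSolution_spec {V : ℝ → ℝ} (hV : Continuous V) {b : ℝ} (hb : ∀ x, |V x| ≤ b)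
    (z a a' : ℂ) : IsSchrodingerSolution V z (ivpSolution V z a a') ∧
      ivpSolution V z a a' 0 = a ∧ deriv (ivpSolution V z a a') 0 = a' :=
  Classical.epsilon_spec (exists_isSchrodingerSolution hV hb z a a')

/-! ### Floquet theory for the unperturbed equation -/

theorem IsSchrodingerSolution.wronskian_eq_of_eqOn {V W : ℝ → ℝ} {z : ℂ} {f g : ℝ → ℂ}
    (hf : IsSchrodingerSolution V z f) (hg : IsSchrodingerSolution W z g) {x y : ℝ}
    (h : ∀ t ∈ Set.uIcc x y, V t = W t) :
    f y * deriv g y - deriv f y * g y = f x * deriv g x - deriv f x * g x := by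
  have := intervalIntegral.integral_eq_sub_of_hasDerivAt (a := x) (b := y) (f' := fun _ => 0)
    (f := fun t => f t * deriv g t - deriv f t * g t) (fun t ht => ?_) (by simp)
  · simpa [eq_comm, sub_eq_zero] using this
  · exact (((hf.hasDerivAt t).mul (hg.2 t)).sub ((hf.2 t).mul (hg.hasDerivAt t))).congr_deriv
      (by rw [h t ht]; ring)

/-- A solution agrees with a solution of another equation where the potentials agree. -/
theorem IsSchrodingerSolution.exists_eqOn {V W : ℝ → ℝ} {z : ℂ} {f : ℝ → ℂ} (hW : Continuous W)
    {b : ℝ} (hb : ∀ x, |W x| ≤ b) (hf : IsSchrodingerSolution V z f) {s : Set ℝ}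
    (hs : s.OrdConnected) (h : ∀ t ∈ s, V t = W t) :
    ∃ y, IsSchrodingerSolution W z y ∧ ∀ x ∈ s, f x = y x ∧ deriv f x = deriv y x := by
  obtain ⟨c, hc, hc0, hc1⟩ := exists_isSchrodingerSolution hW hb z 1 0
  obtain ⟨d, hd, hd0, hd1⟩ := exists_isSchrodingerSolution hW hb z 0 1
  rcases s.eq_empty_or_nonempty with rfl | ⟨r, hr⟩
  · exact ⟨c, hc, by simp⟩
  -- The coefficients are Wronskians of f with the basis, taken at a base point r of s; they stay
  -- constant along s because the potentials agree there.
  have hlin := hc.linearCombination hd (f r * deriv d r - deriv f r * d r)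
    (c r * deriv f r - deriv c r * f r)
  refine ⟨_, hlin.1, fun x hx => ?_⟩
  have hsub := hs.uIcc_subset hr hx
  have e1 := hf.wronskian_eq_of_eqOn hd fun t ht => h t (hsub ht)
  have e2 := hc.wronskian_eq_of_eqOn hf fun t ht => (h t (hsub ht)).symm
  have e3 := hc.wronskian_eq hd 0 x
  rw [hc0, hc1, hd0, hd1, mul_one, zero_mul, sub_zero] at e3
  rw [hlin.2]
  dsimp only
  rw [← e1, ← e2]
  constructor
  · linear_combination (-f x) * e3
  · linear_combination (-deriv f x) * e3

/-- Cayley-Hamilton for the monodromy map, together with a Floquet solution for the multiplier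
`l`, whenever `l ^ 2 ≠ 1`. -/
theorem exists_discriminant {W : ℝ → ℝ} (hW : Continuous W) {b : ℝ} (hb : ∀ x, |W x| ≤ b)
    (hper : ∀ x, W (x + 1) = W x) (z : ℂ) :
    ∃ τ : ℂ, (∀ y, IsSchrodingerSolution W z y → ∀ x, y (x + 2) = τ * y (x + 1) - y x ∧
        deriv y (x + 2) = τ * deriv y (x + 1) - deriv y x) ∧
      ∀ l : ℂ, l * l - τ * l + 1 = 0 → l * l ≠ 1 →
        ∃ y, y ≠ 0 ∧ IsSchrodingerSolution W z y ∧ ∀ x, y (x + 1) = l * y x := by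
  obtain ⟨c, hc, hc0, hc1⟩ := exists_isSchrodingerSolution hW hb z 1 0
  obtain ⟨d, hd, hd0, hd1⟩ := exists_isSchrodingerSolution hW hb z 0 1
  have hW0 : c 0 * deriv d 0 - deriv c 0 * d 0 = 1 := by rw [hc0, hc1, hd0, hd1]; ring
  have hcomb : ∀ y, IsSchrodingerSolution W z y → ∀ x, y x = y 0 * c x + deriv y 0 * d x ∧
      deriv y x = y 0 * deriv c x + deriv y 0 * deriv d x := by
    intro y hy x
    have := hc.eq_combination hd hy hW0 x
    rw [hc0, hc1, hd0, hd1] at this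
    simpa using this
  have hshift : ∀ y, IsSchrodingerSolution W z y → ∀ x,
      y (x + 1) = y 1 * c x + deriv y 1 * d x ∧
      deriv y (x + 1) = y 1 * deriv c x + deriv y 1 * deriv d x := by
    intro y hy x
    have h1 := hy.comp_add_const hper
    have := hcomb _ h1.1 x
    rw [h1.2] at this
    simpa using this
  have hdet := hc.wronskian_eq hd 0 1
  rw [hW0] at hdet
  have hrec : ∀ y, IsSchrodingerSolution W z y → ∀ x,
      y (x + 2) = (c 1 + deriv d 1) * y (x + 1) - y x ∧
        deriv y (x + 2) = (c 1 + deriv d 1) * deriv y (x + 1) - deriv y x := by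
    intro y hy x
    have h2 := hshift y hy (x + 1)
    rw [show x + 1 + 1 = x + 2 by ring, (hshift c hc x).1, (hshift d hd x).1, (hshift c hc x).2,
      (hshift d hd x).2] at h2
    have e1 := hcomb y hy 1
    rw [h2.1, h2.2, (hshift y hy x).1, (hshift y hy x).2, (hcomb y hy x).1, (hcomb y hy x).2,
      e1.1, e1.2]
    constructor
    · linear_combination (-(y 0 * c x + deriv y 0 * d x)) * hdet
    · linear_combination (-(y 0 * deriv c x + deriv y 0 * deriv d x)) * hdet
  refine ⟨c 1 + deriv d 1, hrec, fun l hl hl1 => ?_⟩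
  -- The trace of the monodromy minus l is the other multiplier; applying "translation minus m" to
  -- any solution yields an eigenvector for l, possibly zero.
  set m := c 1 + deriv d 1 - l with hm
  have hlm : l * m = 1 := by rw [hm]; linear_combination (-1) * hl
  have hfl : ∀ y, IsSchrodingerSolution W z y →
      IsSchrodingerSolution W z (fun x => 1 * y (x + 1) + (-m) * y x) ∧
      ∀ x, (1 * y (x + 1 + 1) + (-m) * y (x + 1)) = l * (1 * y (x + 1) + (-m) * y x) := by
    intro y hy
    refine ⟨((hy.comp_add_const hper).1.linearCombination hy 1 (-m)).1, fun x => ?_⟩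
    rw [show x + 1 + 1 = x + 2 by ring, (hrec y hy x).1, hm]
    linear_combination (-(y x)) * hl
  -- If both basis solutions are annihilated, translation is multiplication by m, its trace is 2m,
  -- and so l = m, contradicting l² ≠ 1.
  by_cases h0 : (fun x => 1 * c (x + 1) + (-m) * c x) = 0
  · by_cases h1 : (fun x => 1 * d (x + 1) + (-m) * d x) = 0
    · exfalso
      apply hl1
      have c1 := congrFun h0 0
      simp only [zero_add, hc0, Pi.zero_apply] at c1
      have hder : deriv (fun x => 1 * d (x + 1) + (-m) * d x) 0 = 0 := by
        rw [h1]; exact deriv_const _ _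
      rw [((hd.comp_add_const hper).1.linearCombination hd 1 (-m)).2] at hder
      simp only [(hd.comp_add_const hper).2, zero_add, hd1] at hder
      have : l = m := by linear_combination (-1) * hm + c1 + hder
      rw [← hlm, ← this]
    · exact ⟨_, h1, (hfl d hd).1, (hfl d hd).2⟩
  · exact ⟨_, h0, (hfl c hc).1, (hfl c hc).2⟩

/-- Past R the function e^{-κx}‖h(x)‖ is 1-periodic, so its maximum over [0, R + 1] controls it on
the whole half-line. -/
theorem exists_bound_of_multiplicative {h : ℝ → ℂ} (hc : Continuous h) {R κ : ℝ} {l : ℂ}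
    (hR : 0 ≤ R) (hl : ‖l‖ = Real.exp κ) (hm : ∀ x, R ≤ x → h (x + 1) = l * h x) :
    ∃ C, ∀ x, 0 ≤ x → ‖h x‖ ≤ C * Real.exp (κ * x) := by
  obtain ⟨C, hC⟩ := (isCompact_Icc (a := (0 : ℝ)) (b := R + 1)).exists_bound_of_continuousOn
    (f := fun x => Real.exp (-(κ * x)) • h x) (by fun_prop)
  have hC' : ∀ x ∈ Set.Icc 0 (R + 1), ‖h x‖ ≤ C * Real.exp (κ * x) := by
    intro x hx
    have := hC x hx
    rw [norm_smul, Real.norm_eq_abs, Real.abs_exp, Real.exp_neg, inv_mul_le_iff₀ (Real.exp_pos _)]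
      at this
    linarith
  have hn : ∀ n : ℕ, ∀ x ∈ Set.Icc 0 (R + 1 + n), ‖h x‖ ≤ C * Real.exp (κ * x) := by
    intro n
    induction n with
    | zero => simpa using hC'
    | succ n ih =>
      intro x hx
      rcases le_total x (R + 1) with h1 | h1
      · exact hC' x ⟨hx.1, h1⟩
      · have h2 := ih (x - 1) ⟨by linarith, by have := hx.2; push_cast at this; linarith⟩
        have h3 := hm (x - 1) (by linarith)
        rw [sub_add_cancel] at h3
        rw [h3, norm_mul, hl]
        calc _ ≤ Real.exp κ * (C * Real.exp (κ * (x - 1))) := by gcongr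
          _ = C * (Real.exp κ * Real.exp (κ * (x - 1))) := by ring
          _ = _ := by rw [← Real.exp_add]; ring_nf
  refine ⟨C, fun x hx => ?_⟩
  obtain ⟨n, hxn⟩ := exists_nat_ge x
  exact hn n x ⟨hx, by linarith⟩

/-- Growth of the solutions of a hyperbolic two-term recurrence. -/
theorem exists_bound_of_recurrence {y : ℝ → ℂ} (hc : Continuous y) {R κ : ℝ} {l m : ℂ}
    (hR : 0 ≤ R) (hκ : 0 < κ) (hlm : l * m = 1) (hl : ‖l‖ = Real.exp κ)
    (hm : ∀ x, R ≤ x → y (x + 2) = (l + m) * y (x + 1) - y x) :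
    ∃ C, ∀ x, 0 ≤ x → ‖y x‖ ≤ C * Real.exp (κ * x) := by
  have hmn : ‖m‖ = Real.exp (-κ) := by
    have := congrArg norm hlm
    rw [norm_mul, hl, norm_one] at this
    rw [Real.exp_neg]
    exact eq_inv_of_mul_eq_one_right this
  -- The recurrence factors: translation multiplies y(x+1) - m y(x) by l and y(x+1) - l y(x) by m.
  -- Their difference is (l - m) y(x).
  obtain ⟨C₁, h1⟩ := exists_bound_of_multiplicative (h := fun x => y (x + 1) - m * y x)
    (by fun_prop) hR hl (fun x hx => by
      rw [show x + 1 + 1 = x + 2 by ring, hm x hx]; linear_combination y x * hlm)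
  obtain ⟨C₂, h2⟩ := exists_bound_of_multiplicative (h := fun x => y (x + 1) - l * y x)
    (by fun_prop) hR hmn (fun x hx => by
      rw [show x + 1 + 1 = x + 2 by ring, hm x hx]; linear_combination y x * hlm)
  have hne : 0 < ‖l - m‖ := by
    rw [norm_pos_iff, sub_ne_zero]
    intro h
    rw [h, hmn, Real.exp_eq_exp] at hl
    linarith
  have hC2 : 0 ≤ C₂ := by simpa using (norm_nonneg _).trans (h2 0 le_rfl)
  refine ⟨(C₁ + C₂) / ‖l - m‖, fun x hx => ?_⟩
  rw [div_mul_eq_mul_div, le_div_iff₀ hne, ← norm_mul,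
    show y x * (l - m) = (y (x + 1) - m * y x) - (y (x + 1) - l * y x) by ring, add_mul]
  refine (norm_sub_le _ _).trans (add_le_add (h1 x hx) ((h2 x hx).trans ?_))
  have : 0 ≤ κ * x := by positivity
  gcongr
  linarith

/-- A square-integrable function cannot be multiplied by a number of modulus at least one under
translations unless it vanishes. -/
theorem eq_zero_of_memLp_of_multiplicative {h : ℝ → ℂ} (hc : Continuous h)
    (hL : MemLp h 2 (volume : Measure ℝ)) {R : ℝ} {l : ℂ} (hl : 1 ≤ ‖l‖)
    (hm : ∀ x, R ≤ x → h (x + 1) = l * h x) {x : ℝ} (hx : R ≤ x) : h x = 0 := by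
  have hint : Integrable (fun x => ‖h x‖ ^ 2) volume := by
    simpa using hL.integrable_norm_pow two_ne_zero
  have hci : ∀ a b, IntervalIntegrable (fun x => ‖h x‖ ^ 2) volume a b := fun a b =>
    Continuous.intervalIntegrable (by fun_prop) _ _
  -- The mass of a unit cell is a difference of two partial integrals with the same limit. It tends
  -- to zero along translates, yet cannot decrease because ‖l‖ ≥ 1.
  have hlim : Filter.Tendsto (fun n : ℕ => ∫ t in (x + n)..(x + n + 1), ‖h t‖ ^ 2) Filter.atTop
      (nhds 0) := by
    have h1 : Filter.Tendsto (fun n : ℕ => x + (n : ℝ)) Filter.atTop Filter.atTop :=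
      Filter.tendsto_atTop_add_const_left _ _ tendsto_natCast_atTop_atTop
    have h2 : Filter.Tendsto (fun n : ℕ => x + (n : ℝ) + 1) Filter.atTop Filter.atTop :=
      Filter.tendsto_atTop_add_const_right _ _ h1
    have t1 := intervalIntegral_tendsto_integral_Ioi x hint.integrableOn h1
    have t2 := intervalIntegral_tendsto_integral_Ioi x hint.integrableOn h2
    have := t2.sub t1
    rw [sub_self] at this
    refine this.congr fun n => ?_
    rw [intervalIntegral.integral_interval_sub_left (hci _ _) (hci _ _)]
  have hmono : ∀ n : ℕ, ∫ t in x..(x + 1), ‖h t‖ ^ 2 ≤ ∫ t in (x + n)..(x + n + 1), ‖h t‖ ^ 2 := by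
    intro n
    induction n with
    | zero => simp
    | succ n ih =>
      refine ih.trans ?_
      rw [show x + ((n + 1 : ℕ) : ℝ) = x + n + 1 by push_cast; ring,
        ← intervalIntegral.integral_comp_add_right (fun t => ‖h t‖ ^ 2) 1]
      refine intervalIntegral.integral_mono_on (by linarith) (hci _ _)
        (Continuous.intervalIntegrable (by fun_prop) _ _) fun t ht => ?_
      have : R ≤ t := by have := ht.1; have : (0 : ℝ) ≤ n := n.cast_nonneg; linarith
      rw [hm t this, norm_mul]
      gcongr
      exact le_mul_of_one_le_left (norm_nonneg _) hl
  have hle : ∫ t in x..(x + 1), ‖h t‖ ^ 2 ≤ 0 := ge_of_tendsto' hlim hmono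
  by_contra hne
  have hpos : 0 < ∫ t in x..(x + 1), ‖h t‖ ^ 2 :=
    intervalIntegral.integral_pos (by linarith) (by fun_prop) (fun t _ => by positivity)
      ⟨x, ⟨le_rfl, by linarith⟩, by positivity⟩
  linarith

/-- A square-integrable solution of a two-term recurrence with `‖l‖ ≥ 1` only sees the contracting
multiplier. -/
theorem eq_mul_of_memLp_of_recurrence {y : ℝ → ℂ} (hc : Continuous y)
    (hL : MemLp y 2 (volume : Measure ℝ)) {R : ℝ} {l m : ℂ} (hlm : l * m = 1) (hl : 1 ≤ ‖l‖)
    (hm : ∀ x, R ≤ x → y (x + 2) = (l + m) * y (x + 1) - y x) {x : ℝ} (hx : R ≤ x) :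
    y (x + 1) = m * y x := by
  have hshift : MemLp (fun x => y (x + 1)) 2 (volume : Measure ℝ) :=
    hL.comp_measurePreserving (measurePreserving_add_right volume 1)
  refine sub_eq_zero.1 (eq_zero_of_memLp_of_multiplicative (h := fun x => y (x + 1) - m * y x)
    (by fun_prop) (hshift.sub (hL.const_mul m)) hl (fun x hx => ?_) hx)
  rw [show x + 1 + 1 = x + 2 by ring, hm x hx]; linear_combination y x * hlm

/-- Exponential decay of square-integrable solutions of the recurrence. -/
theorem exists_decay_of_memLp {y : ℝ → ℂ} (hd : Differentiable ℝ y) (hc : Continuous (deriv y))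
    (hL : MemLp y 2 (volume : Measure ℝ)) {R κ : ℝ} {l m : ℂ} (hR : 0 ≤ R) (hlm : l * m = 1)
    (hκ : 0 < κ) (hl : ‖l‖ = Real.exp κ)
    (hm : ∀ x, R ≤ x → y (x + 2) = (l + m) * y (x + 1) - y x) :
    ∃ C, ∀ x, 0 ≤ x → ‖y x‖ ≤ C * Real.exp (-κ * x) ∧ ‖deriv y x‖ ≤ C * Real.exp (-κ * x) := by
  have hmn : ‖m‖ = Real.exp (-κ) := by
    have := congrArg norm hlm
    rw [norm_mul, hl, norm_one] at this
    rw [Real.exp_neg]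
    exact eq_inv_of_mul_eq_one_right this
  have h1 : ∀ x, R ≤ x → y (x + 1) = m * y x := fun x hx =>
    eq_mul_of_memLp_of_recurrence hd.continuous hL hlm
      (by rw [hl]; exact Real.one_le_exp hκ.le) hm hx
  have h2 : ∀ x, R + 1 ≤ x → deriv y (x + 1) = m * deriv y x := by
    intro x hx
    have e : (fun t => y (t + 1)) =ᶠ[nhds x] fun t => m * y t := by
      filter_upwards [lt_mem_nhds (show R < x by linarith)] with t ht using h1 t ht.le
    have := e.deriv_eq
    rwa [deriv_comp_add_const, deriv_const_mul _ (hd x)] at this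
  obtain ⟨C₁, hC₁⟩ := exists_bound_of_multiplicative hd.continuous hR hmn h1
  obtain ⟨C₂, hC₂⟩ := exists_bound_of_multiplicative hc (by linarith) hmn h2
  exact ⟨max C₁ C₂, fun x hx =>
    ⟨(hC₁ x hx).trans (by gcongr; exact le_max_left _ _),
      (hC₂ x hx).trans (by gcongr; exact le_max_right _ _)⟩⟩

/-- Only V is assumed regular; near any point W is a translate of V from beyond the defect, which
transfers continuity. -/
theorem continuous_periodic_part {V W : ℝ → ℝ} (hV : Continuous V) {ρ : ℝ}
    (hVW : ∀ x, ρ < |x| → V x = W x) (hper : ∀ x, W (x + 1) = W x) : Continuous W := by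
  rw [continuous_iff_continuousAt]
  intro x
  obtain ⟨n, hn⟩ := exists_nat_gt (ρ - x + 1)
  obtain ⟨n', hn'⟩ := exists_nat_gt (-x + 1)
  have hW : ∀ t, W t = W (t + (n + n' : ℕ)) := fun t => by
    have : Function.Periodic W 1 := hper
    have := this.nat_mul (n + n') t
    rw [mul_one] at this
    exact this.symm
  have hc : ContinuousAt (fun t => V (t + (n + n' : ℕ))) x := by fun_prop
  refine hc.congr ?_
  filter_upwards [lt_mem_nhds (show x - 1 < x by linarith)] with t ht
  rw [hW t]
  refine hVW _ (lt_of_lt_of_le ?_ (le_abs_self _))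
  push_cast
  have : (0 : ℝ) ≤ n' := n'.cast_nonneg
  linarith

theorem exists_bound_periodic {W : ℝ → ℝ} (hW : Continuous W) (hper : ∀ x, W (x + 1) = W x) :
    ∃ b, ∀ x, |W x| ≤ b := by
  obtain ⟨b, hb⟩ := (isCompact_Icc (a := (0 : ℝ)) (b := 1)).exists_bound_of_continuousOn
    (f := W) hW.continuousOn
  refine ⟨b, fun x => ?_⟩
  obtain ⟨y, hy, hxy⟩ := (show Function.Periodic W 1 from hper).exists_mem_Ico₀ one_pos x
  rw [hxy]
  exact hb y ⟨hy.1, hy.2.le⟩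

theorem exists_bound_of_eq_periodic {V W : ℝ → ℝ} (hV : Continuous V) {ρ : ℝ}
    (hVW : ∀ x, ρ < |x| → V x = W x) {b : ℝ} (hb : ∀ x, |W x| ≤ b) : ∃ b, ∀ x, |V x| ≤ b := by
  obtain ⟨b', hb'⟩ := (isCompact_Icc (a := -ρ) (b := ρ)).exists_bound_of_continuousOn
    (f := V) hV.continuousOn
  refine ⟨max b b', fun x => ?_⟩
  rcases le_or_gt |x| ρ with h | h
  · exact (hb' x (abs_le.1 h)).trans (le_max_right _ _)
  · rw [hVW x h]
    exact (hb x).trans (le_max_left _ _)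

/-- A solution that vanishes on a half-line vanishes. -/
theorem IsSchrodingerSolution.eq_zero_of_eventually {V : ℝ → ℝ} {z : ℂ} {f : ℝ → ℂ}
    (hV : Continuous V) {b : ℝ} (hb : ∀ x, |V x| ≤ b) (hf : IsSchrodingerSolution V z f) {r : ℝ}
    (h0 : ∀ x, r ≤ x → f x = 0) : f = 0 := by
  obtain ⟨u, hu, hu0, hu1⟩ := exists_isSchrodingerSolution hV hb z 1 0
  obtain ⟨v, hv, hv0, hv1⟩ := exists_isSchrodingerSolution hV hb z 0 1
  have hW : u 0 * deriv v 0 - deriv u 0 * v 0 = 1 := by rw [hu0, hu1, hv0, hv1]; ring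
  have hd : deriv f (r + 1) = 0 := by
    have e : f =ᶠ[nhds (r + 1)] fun _ => 0 := by
      filter_upwards [lt_mem_nhds (show r < r + 1 by linarith)] with t ht using h0 t ht.le
    rw [e.deriv_eq, deriv_const]
  have h1 := hf.wronskian_eq hv (r + 1) 0
  have h2 := hu.wronskian_eq hf (r + 1) 0
  rw [h0 (r + 1) (by linarith), hd, zero_mul, zero_mul, sub_zero] at h1
  rw [h0 (r + 1) (by linarith), hd, mul_zero, mul_zero, sub_zero] at h2
  funext x
  rw [(hu.eq_combination hv hf hW x).1, h1, h2]
  simp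

theorem exists_multipliers (τ : ℂ) : ∃ l m : ℂ, l * m = 1 ∧ l + m = τ ∧ 1 ≤ ‖l‖ := by
  obtain ⟨s, hs⟩ := IsAlgClosed.exists_pow_nat_eq (τ ^ 2 / 4 - 1) (n := 2) two_pos
  have hp : (τ / 2 + s) * (τ / 2 - s) = 1 := by linear_combination (-1) * hs
  rcases le_total 1 ‖τ / 2 + s‖ with h | h
  · exact ⟨τ / 2 + s, τ / 2 - s, hp, by ring, h⟩
  · refine ⟨τ / 2 - s, τ / 2 + s, by rw [mul_comm, hp], by ring, ?_⟩
    have := congrArg norm hp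
    rw [norm_mul, norm_one] at this
    nlinarith [norm_nonneg (τ / 2 - s)]

/-- A bound state forces the unperturbed equation to be hyperbolic; it decays, and the other
solutions grow, at the rate given by the Floquet exponent. -/
theorem IsBoundState.exists_floquetExponent {V W : ℝ → ℝ} {ρ E : ℝ} {Φ : ℝ → ℂ} (hρ : 0 ≤ ρ)
    (hV : Continuous V) (hVW : ∀ x, ρ < |x| → V x = W x) (hper : ∀ x, W (x + 1) = W x)
    (hΦ : IsBoundState V E Φ) :
    ∃ κ, IsFloquetExponent W E κ ∧
      (∃ C, ∀ x, 0 ≤ x → (‖Φ x‖ ≤ C * Real.exp (-κ * x) ∧ ‖deriv Φ x‖ ≤ C * Real.exp (-κ * x)) ∧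
        ‖Φ (-x)‖ ≤ C * Real.exp (-κ * x) ∧ ‖deriv Φ (-x)‖ ≤ C * Real.exp (-κ * x)) ∧
      ∀ f, IsSchrodingerSolution V E f →
        ∃ C, ∀ x, 0 ≤ x → (‖f x‖ ≤ C * Real.exp (κ * x) ∧ ‖deriv f x‖ ≤ C * Real.exp (κ * x)) ∧
          ‖f (-x)‖ ≤ C * Real.exp (κ * x) ∧ ‖deriv f (-x)‖ ≤ C * Real.exp (κ * x) := by
  have hW := continuous_periodic_part hV hVW hper
  obtain ⟨bW, hbW⟩ := exists_bound_periodic hW hper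
  obtain ⟨bV, hbV⟩ := exists_bound_of_eq_periodic hV hVW hbW
  obtain ⟨τ, hrec, hfl⟩ := exists_discriminant hW hbW hper (E : ℂ)
  obtain ⟨l, m, hlm, rfl, hl1⟩ := exists_multipliers τ
  set R := ρ + 1 with hRdef
  have hR : 0 ≤ R := by linarith
  have hR2 : 0 ≤ R + 2 := by linarith
  have hright : ∀ f, IsSchrodingerSolution V E f → ∀ x, R + 2 ≤ x →
      f (x + 2) = (l + m) * f (x + 1) - f x ∧
      deriv f (x + 2) = (l + m) * deriv f (x + 1) - deriv f x := by
    intro f hf x hx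
    obtain ⟨y, hy, hfy⟩ := hf.exists_eqOn hW hbW (s := Set.Ici R) Set.ordConnected_Ici
      fun t ht => hVW t (by
        have : R ≤ t := ht
        exact lt_of_lt_of_le (by linarith) (le_abs_self t))
    have h0 := hfy x (by rw [Set.mem_Ici]; linarith)
    have h1 := hfy (x + 1) (by rw [Set.mem_Ici]; linarith)
    have h2 := hfy (x + 2) (by rw [Set.mem_Ici]; linarith)
    rw [h0.1, h0.2, h1.1, h1.2, h2.1, h2.2]
    exact hrec y hy x
  have hleft : ∀ f, IsSchrodingerSolution V E f → ∀ x, R + 2 ≤ x →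
      f (-(x + 2)) = (l + m) * f (-(x + 1)) - f (-x) ∧
      deriv f (-(x + 2)) = (l + m) * deriv f (-(x + 1)) - deriv f (-x) := by
    intro f hf x hx
    obtain ⟨y, hy, hfy⟩ := hf.exists_eqOn hW hbW (s := Set.Iic (-R)) Set.ordConnected_Iic
      fun t ht => hVW t (by
        have : t ≤ -R := ht
        exact lt_of_lt_of_le (by linarith) (neg_le_abs t))
    have h0 := hfy (-x) (by rw [Set.mem_Iic]; linarith)
    have h1 := hfy (-(x + 1)) (by rw [Set.mem_Iic]; linarith)
    have h2 := hfy (-(x + 2)) (by rw [Set.mem_Iic]; linarith)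
    rw [h0.1, h0.2, h1.1, h1.2, h2.1, h2.2]
    have h3 := hrec y hy (-(x + 2))
    rw [show -(x + 2) + 2 = -x by ring, show -(x + 2) + 1 = -(x + 1) by ring] at h3
    exact ⟨by linear_combination h3.1, by linear_combination h3.2⟩
  obtain ⟨hne, hL2, hsol⟩ := hΦ
  -- If ‖l‖ = 1, both multipliers are unimodular. Square integrability first kills the l-component
  -- of Φ, then the m-component, so Φ vanishes on a half-line and hence identically.
  have hlgt : 1 < ‖l‖ := by
    refine lt_of_le_of_ne hl1 fun heq => hne ?_
    have hm1 : ‖m‖ = 1 := by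
      have := congrArg norm hlm
      rwa [norm_mul, ← heq, one_mul, norm_one] at this
    exact hsol.eq_zero_of_eventually hV hbV fun x hx =>
      eq_zero_of_memLp_of_multiplicative hsol.continuous hL2 hm1.ge
        (fun x hx => eq_mul_of_memLp_of_recurrence hsol.continuous hL2 hlm hl1
          (fun x hx => (hright Φ hsol x hx).1) hx) hx
  have hκ : 0 < Real.log ‖l‖ := Real.log_pos hlgt
  have hlκ : ‖l‖ = Real.exp (Real.log ‖l‖) := (Real.exp_log (by linarith)).symm
  refine ⟨Real.log ‖l‖, ⟨hκ, ?_⟩, ?_, ?_⟩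
  · obtain ⟨y, hy⟩ := hfl l (by linear_combination (-1) * hlm) (fun h => by
      have := congrArg norm h
      rw [norm_mul, norm_one] at this
      nlinarith)
    exact ⟨l, y, hlκ, hy⟩
  · obtain ⟨C₁, h1⟩ := exists_decay_of_memLp hsol.1 hsol.continuous_deriv hL2 hR2 hlm hκ hlκ
      fun x hx => (hright Φ hsol x hx).1
    have hneg := hsol.comp_neg
    have hL2' : MemLp (fun x => Φ (-x)) 2 (volume : Measure ℝ) :=
      hL2.comp_measurePreserving (Measure.measurePreserving_neg volume)
    obtain ⟨C₂, h2⟩ := exists_decay_of_memLp hneg.1.1 hneg.1.continuous_deriv hL2' hR2 hlm hκ hlκ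
      fun x hx => (hleft Φ hsol x hx).1
    rw [hneg.2] at h2
    simp only [norm_neg] at h2
    refine ⟨max C₁ C₂, fun x hx => ⟨⟨(h1 x hx).1.trans ?_, (h1 x hx).2.trans ?_⟩,
      (h2 x hx).1.trans ?_, (h2 x hx).2.trans ?_⟩⟩ <;> gcongr
    exacts [le_max_left _ _, le_max_left _ _, le_max_right _ _, le_max_right _ _]
  · intro f hf
    have hfc := hf.continuous
    have hfd := hf.continuous_deriv
    obtain ⟨C₁, h1⟩ := exists_bound_of_recurrence hfc hR2 hκ hlm hlκ
      fun x hx => (hright f hf x hx).1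
    obtain ⟨C₂, h2⟩ := exists_bound_of_recurrence hfd hR2 hκ hlm hlκ
      fun x hx => (hright f hf x hx).2
    obtain ⟨C₃, h3⟩ := exists_bound_of_recurrence (y := fun x => f (-x)) (by fun_prop) hR2 hκ hlm
      hlκ fun x hx => (hleft f hf x hx).1
    obtain ⟨C₄, h4⟩ := exists_bound_of_recurrence (y := fun x => deriv f (-x)) (by fun_prop) hR2 hκ
      hlm hlκ fun x hx => (hleft f hf x hx).2
    refine ⟨max (max C₁ C₂) (max C₃ C₄), fun x hx => ⟨⟨(h1 x hx).trans ?_, (h2 x hx).trans ?_⟩,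
      (h3 x hx).trans ?_, (h4 x hx).trans ?_⟩⟩ <;> gcongr <;> simp

/-! ### The principal square root near the positive axis -/

theorem csqrt_sq (z : ℂ) : csqrt z ^ 2 = z := by
  rw [csqrt, ← Complex.cpow_nat_mul]
  norm_num

theorem csqrt_ofReal {E : ℝ} (hE : 0 ≤ E) : csqrt E = (Real.sqrt E : ℂ) := by
  rw [csqrt, Real.sqrt_eq_rpow, Complex.ofReal_cpow hE]
  norm_num

theorem csqrt_re_nonneg (z : ℂ) : 0 ≤ (csqrt z).re := by
  rcases eq_or_ne z 0 with rfl | hz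
  · simp [csqrt]
  rw [csqrt, Complex.cpow_def_of_ne_zero hz, Complex.exp_re]
  refine mul_nonneg (Real.exp_pos _).le (Real.cos_nonneg_of_mem_Icc ?_)
  have h : (Complex.log z * (1 / 2)).im = z.arg / 2 := by
    rw [show (1 / 2 : ℂ) = ((1 / 2 : ℝ) : ℂ) by push_cast; rfl, Complex.im_mul_ofReal,
      Complex.log_im]
    ring
  rw [h]
  constructor <;> linarith [Complex.neg_pi_lt_arg z, Complex.arg_le_pi z]

theorem sqrt_le_csqrt_re {z : ℂ} {c : ℝ} (hz : c ≤ z.re) : Real.sqrt c ≤ (csqrt z).re := by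
  refine Real.sqrt_le_iff.2 ⟨csqrt_re_nonneg z, hz.trans ?_⟩
  have := congrArg Complex.re (csqrt_sq z)
  rw [pow_two, Complex.mul_re] at this
  nlinarith [sq_nonneg (csqrt z).im]

/-- Factor z - w as (√z - √w)(√z + √w); the second factor has real part at least √c on the principal
branch. -/
theorem norm_csqrt_sub_le {z w : ℂ} {c : ℝ} (hc : 0 < c) (hz : c ≤ z.re) (hw : c ≤ w.re) :
    ‖csqrt z - csqrt w‖ ≤ ‖z - w‖ / Real.sqrt c := by
  have h1 := sqrt_le_csqrt_re hz
  have h2 := sqrt_le_csqrt_re hw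
  have h3 := Real.sqrt_pos.2 hc
  have h4 : Real.sqrt c ≤ ‖csqrt z + csqrt w‖ := by
    refine le_trans ?_ (Complex.re_le_norm _)
    rw [Complex.add_re]
    linarith
  rw [le_div_iff₀ h3]
  calc _ ≤ ‖csqrt z - csqrt w‖ * ‖csqrt z + csqrt w‖ := by gcongr
    _ = ‖z - w‖ := by
      rw [← norm_mul]
      congr 1
      linear_combination csqrt_sq z - csqrt_sq w

/-! ### Perturbation of the decaying solution on a half-line -/

/-- A fundamental system with unit Wronskian made of a decaying and a growing solution. -/
structure IsDichotomyPair (V : ℝ → ℝ) (E κ B : ℝ) (u v : ℝ → ℂ) : Prop where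
  pos : 0 < κ
  sol_u : IsSchrodingerSolution V E u
  sol_v : IsSchrodingerSolution V E v
  wronskian : u 0 * deriv v 0 - deriv u 0 * v 0 = 1
  u_le : ∀ x, 0 ≤ x → ‖u x‖ ≤ B * Real.exp (-κ * x)
  du_le : ∀ x, 0 ≤ x → ‖deriv u x‖ ≤ B * Real.exp (-κ * x)
  v_le : ∀ x, 0 ≤ x → ‖v x‖ ≤ B * Real.exp (κ * x)
  dv_le : ∀ x, 0 ≤ x → ‖deriv v x‖ ≤ B * Real.exp (κ * x)

/-- `f` has the Cauchy data of `(1 + a δ) u + δ v` at `0`. -/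
def HasCombinedData (u v : ℝ → ℂ) (a δ : ℂ) (f : ℝ → ℂ) : Prop :=
  f 0 = (1 + a * δ) * u 0 + δ * v 0 ∧ deriv f 0 = (1 + a * δ) * deriv u 0 + δ * deriv v 0

namespace IsDichotomyPair

variable {V : ℝ → ℝ} {E κ B : ℝ} {u v : ℝ → ℂ}

theorem bound_nonneg (h : IsDichotomyPair V E κ B u v) : 0 ≤ B := by
  simpa using (norm_nonneg _).trans (h.u_le 0 le_rfl)

/-- Both terms of the kernel are O(e^{κ(x-t)}) for 0 ≤ t ≤ x. A decaying source then contributes a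
bounded integral, a growing one a factor x. P and Q are left free so that values at x and outgoing
defects are treated alike. -/
theorem norm_kernel_integral_le (h : IsDichotomyPair V E κ B u v) {P Q : ℂ} {b x G₁ G₂ : ℝ}
    (hx : 0 ≤ x) (hP : ‖P‖ ≤ b * Real.exp (κ * x)) (hQ : ‖Q‖ ≤ b * Real.exp (-κ * x))
    {g : ℝ → ℂ} (hG₁ : 0 ≤ G₁)
    (hg : ∀ t ∈ Set.Icc 0 x, ‖g t‖ ≤ G₁ * Real.exp (-κ * t) + G₂ * Real.exp (κ * t)) :
    ‖∫ t in (0 : ℝ)..x, (P * u t - Q * v t) * g t‖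
      ≤ 2 * b * B * Real.exp (κ * x) * (G₁ / (2 * κ) + G₂ * x) := by
  have hκ := h.pos
  have hB := h.bound_nonneg
  have hb : 0 ≤ b := by
    have := (norm_nonneg _).trans hP
    exact nonneg_of_mul_nonneg_left this (Real.exp_pos _)
  have hpt : ∀ t ∈ Set.Icc 0 x, ‖(P * u t - Q * v t) * g t‖ ≤
      2 * b * B * Real.exp (κ * x) * (G₁ * Real.exp (-(2 * κ) * t) + G₂) := by
    intro t ht
    have h1 : ‖P * u t - Q * v t‖ ≤ 2 * b * B * Real.exp (κ * x) * Real.exp (-κ * t) := by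
      refine (norm_sub_le _ _).trans ?_
      rw [norm_mul, norm_mul]
      have e1 : ‖P‖ * ‖u t‖ ≤ b * Real.exp (κ * x) * (B * Real.exp (-κ * t)) :=
        mul_le_mul hP (h.u_le t ht.1) (norm_nonneg _) (by positivity)
      have e2 : ‖Q‖ * ‖v t‖ ≤ b * Real.exp (-κ * x) * (B * Real.exp (κ * t)) :=
        mul_le_mul hQ (h.v_le t ht.1) (norm_nonneg _) (by positivity)
      have e3 : Real.exp (-κ * x) * Real.exp (κ * t) ≤ Real.exp (κ * x) * Real.exp (-κ * t) := by
        rw [← Real.exp_add, ← Real.exp_add]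
        refine Real.exp_le_exp.2 ?_
        nlinarith [ht.2]
      nlinarith [mul_le_mul_of_nonneg_left e3 (mul_nonneg hb hB)]
    rw [norm_mul]
    calc _ ≤ 2 * b * B * Real.exp (κ * x) * Real.exp (-κ * t)
          * (G₁ * Real.exp (-κ * t) + G₂ * Real.exp (κ * t)) :=
          mul_le_mul h1 (hg t ht) (norm_nonneg _) (by positivity)
      _ = 2 * b * B * Real.exp (κ * x) * (G₁ * (Real.exp (-κ * t) * Real.exp (-κ * t))
          + G₂ * (Real.exp (-κ * t) * Real.exp (κ * t))) := by ring
      _ = _ := by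
        rw [← Real.exp_add, ← Real.exp_add, show -κ * t + κ * t = 0 by ring, Real.exp_zero,
          mul_one, show -κ * t + -κ * t = -(2 * κ) * t by ring]
  refine (intervalIntegral.norm_integral_le_of_norm_le hx
    (g := fun t => 2 * b * B * Real.exp (κ * x) * (G₁ * Real.exp (-(2 * κ) * t) + G₂))
    (Filter.Eventually.of_forall fun t ht => hpt t ⟨ht.1.le, ht.2⟩)
    (Continuous.intervalIntegrable (by fun_prop) _ _)).trans ?_
  rw [intervalIntegral.integral_const_mul, intervalIntegral.integral_add
    (Continuous.intervalIntegrable (by fun_prop) _ _)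
    (Continuous.intervalIntegrable (by fun_prop) _ _), intervalIntegral.integral_const_mul,
    intervalIntegral.integral_comp_mul_left _ (by linarith : -(2 * κ) ≠ 0), integral_exp,
    intervalIntegral.integral_const]
  refine mul_le_mul_of_nonneg_left ?_ (by positivity)
  simp only [mul_zero, Real.exp_zero, smul_eq_mul, sub_zero]
  have e : G₁ * ((-(2 * κ))⁻¹ * (Real.exp (-(2 * κ) * x) - 1))
      = G₁ / (2 * κ) - G₁ / (2 * κ) * Real.exp (-(2 * κ) * x) := by
    field_simp
    ring
  rw [e]
  have : 0 ≤ G₁ / (2 * κ) * Real.exp (-(2 * κ) * x) := by positivity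
  linarith

/-- Variation of parameters. -/
theorem integral_representation (h : IsDichotomyPair V E κ B u v) {z a δ : ℂ} {f : ℝ → ℂ}
    (hf : IsSchrodingerSolution V z f) (hd : HasCombinedData u v a δ f) (c c' : ℂ) (x : ℝ) :
    c * deriv f x + c' * f x = (1 + a * δ) * (c * deriv u x + c' * u x)
      + δ * (c * deriv v x + c' * v x)
      - ∫ t in (0 : ℝ)..x, ((c * deriv v x + c' * v x) * u t - (c * deriv u x + c' * u x) * v t)
          * ((z - E) * f t) := by
  have h1 := h.sol_u.wronskian_sub hf 0 x
  have h2 := hf.wronskian_sub h.sol_v 0 x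
  have h3 := h.sol_u.wronskian_eq h.sol_v 0 x
  have hcu := h.sol_u.continuous
  have hcv := h.sol_v.continuous
  have hcf := hf.continuous
  rw [h.wronskian] at h3
  have e : ∫ t in (0 : ℝ)..x, ((c * deriv v x + c' * v x) * u t
      - (c * deriv u x + c' * u x) * v t) * ((z - E) * f t)
      = (c * deriv v x + c' * v x) * (z - E) * (∫ t in (0 : ℝ)..x, u t * f t)
        - (c * deriv u x + c' * u x) * (z - E) * ∫ t in (0 : ℝ)..x, f t * v t := by
    rw [← intervalIntegral.integral_const_mul, ← intervalIntegral.integral_const_mul,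
      ← intervalIntegral.integral_sub (Continuous.intervalIntegrable (by fun_prop) _ _)
        (Continuous.intervalIntegrable (by fun_prop) _ _)]
    exact intervalIntegral.integral_congr fun t _ => by ring
  rw [e]
  rw [hd.1, hd.2] at h1 h2
  linear_combination (c * deriv v x + c' * v x) * h1 + (c * deriv u x + c' * u x) * h2
    - (c * deriv f x + c' * f x) * h3
    + (δ * (c * deriv v x + c' * v x) + (1 + a * δ) * (c * deriv u x + c' * u x)) * h.wronskian

theorem integral_representation_sub (h : IsDichotomyPair V E κ B u v) {z₁ z₂ a δ₁ δ₂ : ℂ}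
    {f₁ f₂ : ℝ → ℂ} (hf₁ : IsSchrodingerSolution V z₁ f₁) (hd₁ : HasCombinedData u v a δ₁ f₁)
    (hf₂ : IsSchrodingerSolution V z₂ f₂) (hd₂ : HasCombinedData u v a δ₂ f₂) (c c' : ℂ) (x : ℝ) :
    c * (deriv f₁ x - deriv f₂ x) + c' * (f₁ x - f₂ x)
      = a * (δ₁ - δ₂) * (c * deriv u x + c' * u x) + (δ₁ - δ₂) * (c * deriv v x + c' * v x)
      - ∫ t in (0 : ℝ)..x, ((c * deriv v x + c' * v x) * u t - (c * deriv u x + c' * u x) * v t)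
          * ((z₁ - E) * (f₁ t - f₂ t) + (z₁ - z₂) * f₂ t) := by
  have h1 := h.integral_representation hf₁ hd₁ c c' x
  have h2 := h.integral_representation hf₂ hd₂ c c' x
  have hcu := h.sol_u.continuous
  have hcv := h.sol_v.continuous
  have hcf₁ := hf₁.continuous
  have hcf₂ := hf₂.continuous
  have e : ∫ t in (0 : ℝ)..x, ((c * deriv v x + c' * v x) * u t
        - (c * deriv u x + c' * u x) * v t) * ((z₁ - E) * (f₁ t - f₂ t) + (z₁ - z₂) * f₂ t)
      = (∫ t in (0 : ℝ)..x, ((c * deriv v x + c' * v x) * u t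
          - (c * deriv u x + c' * u x) * v t) * ((z₁ - E) * f₁ t))
        - ∫ t in (0 : ℝ)..x, ((c * deriv v x + c' * v x) * u t
          - (c * deriv u x + c' * u x) * v t) * ((z₂ - E) * f₂ t) := by
    rw [← intervalIntegral.integral_sub (Continuous.intervalIntegrable (by fun_prop) _ _)
        (Continuous.intervalIntegrable (by fun_prop) _ _)]
    exact intervalIntegral.integral_congr fun t _ => by ring
  rw [e]
  linear_combination h1 - h2

/-- Lipschitz dependence, weighted by the growth rate, on the energy and the initial data. -/
theorem norm_sub_le (h : IsDichotomyPair V E κ B u v) {a : ℂ} {C : ℝ} (hC : 0 ≤ C) {M r : ℝ}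
    (hM : 0 ≤ M) (hMr : M * r ≤ 1) (hBMr : 4 * B ^ 2 * (M * r) ≤ 1) (hr : 0 ≤ r)
    {z₁ z₂ δ₁ δ₂ : ℂ} {f₁ f₂ : ℝ → ℂ} (hz₁ : ‖z₁ - E‖ ≤ r)
    (hf₁ : IsSchrodingerSolution V z₁ f₁) (hd₁ : HasCombinedData u v a δ₁ f₁)
    (hf₂ : IsSchrodingerSolution V z₂ f₂) (hd₂ : HasCombinedData u v a δ₂ f₂)
    (hb₂ : ∀ t ∈ Set.Icc 0 M, ‖f₂ t‖ ≤ C * (Real.exp (-κ * t) + r * Real.exp (κ * t)))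
    {x : ℝ} (hx : x ∈ Set.Icc 0 M) :
    ‖f₁ x - f₂ x‖ ≤ 2 * (B * (‖a‖ + 1) + 2 * B ^ 2 * C * (1 / (2 * κ) + 1))
      * (‖δ₁ - δ₂‖ + ‖z₁ - z₂‖) * Real.exp (κ * x) := by
  have hκ := h.pos
  have hB := h.bound_nonneg
  have hcf₁ := hf₁.continuous
  have hcf₂ := hf₂.continuous
  -- The supremum S of the weighted difference is attained; evaluating the integral equation at the
  -- maximizer bounds S by a multiple of Δ plus a small multiple of S.
  obtain ⟨x₀, hx₀, hmax⟩ := (isCompact_Icc (a := (0 : ℝ)) (b := M)).exists_isMaxOn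
    ⟨0, le_rfl, hM⟩ (f := fun t => ‖f₁ t - f₂ t‖ * Real.exp (-(κ * t)))
    (Continuous.continuousOn (by fun_prop))
  set S := ‖f₁ x₀ - f₂ x₀‖ * Real.exp (-(κ * x₀)) with hS
  have hS0 : 0 ≤ S := by positivity
  have hbound : ∀ t ∈ Set.Icc 0 M, ‖f₁ t - f₂ t‖ ≤ S * Real.exp (κ * t) := by
    intro t ht
    have h1 : ‖f₁ t - f₂ t‖ * Real.exp (-(κ * t)) ≤ S := hmax ht
    rwa [Real.exp_neg, ← div_eq_mul_inv, div_le_iff₀ (Real.exp_pos _)] at h1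
  set Δ := ‖δ₁ - δ₂‖ + ‖z₁ - z₂‖ with hΔ
  have hΔ0 : 0 ≤ Δ := by positivity
  have hδΔ : ‖δ₁ - δ₂‖ ≤ Δ := by rw [hΔ]; linarith [norm_nonneg (z₁ - z₂)]
  have hzΔ : ‖z₁ - z₂‖ ≤ Δ := by rw [hΔ]; linarith [norm_nonneg (δ₁ - δ₂)]
  have hrep := h.integral_representation_sub hf₁ hd₁ hf₂ hd₂ 0 1 x₀
  simp only [zero_mul, one_mul, zero_add] at hrep
  have hker := h.norm_kernel_integral_le hx₀.1 (h.v_le x₀ hx₀.1) (h.u_le x₀ hx₀.1)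
    (g := fun t => (z₁ - E) * (f₁ t - f₂ t) + (z₁ - z₂) * f₂ t) (G₁ := Δ * C)
    (G₂ := r * S + Δ * (C * r)) (by positivity) (fun t ht => by
      have ht' : t ∈ Set.Icc 0 M := ⟨ht.1, ht.2.trans hx₀.2⟩
      refine (norm_add_le _ _).trans ?_
      rw [norm_mul, norm_mul]
      have e1 : ‖z₁ - E‖ * ‖f₁ t - f₂ t‖ ≤ r * (S * Real.exp (κ * t)) :=
        mul_le_mul hz₁ (hbound t ht') (norm_nonneg _) hr
      have e2 : ‖z₁ - z₂‖ * ‖f₂ t‖ ≤ Δ * (C * (Real.exp (-κ * t) + r * Real.exp (κ * t))) :=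
        mul_le_mul hzΔ (hb₂ t ht') (norm_nonneg _) hΔ0
      linarith)
  have hexp : Real.exp (-κ * x₀) ≤ Real.exp (κ * x₀) :=
    Real.exp_le_exp.2 (by nlinarith [hx₀.1])
  have hmain : ‖f₁ x₀ - f₂ x₀‖ ≤ (‖a‖ * Δ * B + Δ * B
      + 2 * B * B * (Δ * C / (2 * κ) + (r * S + Δ * (C * r)) * M)) * Real.exp (κ * x₀) := by
    rw [hrep]
    refine (_root_.norm_sub_le _ _).trans ?_
    have e1 : ‖a * (δ₁ - δ₂) * u x₀ + (δ₁ - δ₂) * v x₀‖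
        ≤ (‖a‖ * Δ * B + Δ * B) * Real.exp (κ * x₀) := by
      refine (norm_add_le _ _).trans ?_
      rw [norm_mul, norm_mul, norm_mul]
      have i1 : ‖a‖ * ‖δ₁ - δ₂‖ * ‖u x₀‖ ≤ ‖a‖ * Δ * (B * Real.exp (κ * x₀)) :=
        mul_le_mul (by gcongr) ((h.u_le x₀ hx₀.1).trans (by gcongr)) (norm_nonneg _)
          (by positivity)
      have i2 : ‖δ₁ - δ₂‖ * ‖v x₀‖ ≤ Δ * (B * Real.exp (κ * x₀)) :=
        mul_le_mul hδΔ (h.v_le x₀ hx₀.1) (norm_nonneg _) hΔ0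
      linarith
    have e2 : 2 * B * B * Real.exp (κ * x₀) * (Δ * C / (2 * κ) + (r * S + Δ * (C * r)) * x₀)
        ≤ 2 * B * B * Real.exp (κ * x₀) * (Δ * C / (2 * κ) + (r * S + Δ * (C * r)) * M) := by
      have := hx₀.2
      gcongr
    linarith [hker.trans e2]
  have hSle : S ≤ ‖a‖ * Δ * B + Δ * B
      + 2 * B * B * (Δ * C / (2 * κ) + (r * S + Δ * (C * r)) * M) := by
    have hSe : S * Real.exp (κ * x₀) = ‖f₁ x₀ - f₂ x₀‖ := by
      rw [hS, mul_assoc, ← Real.exp_add, neg_add_cancel, Real.exp_zero, mul_one]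
    exact le_of_mul_le_mul_right (hSe.trans_le hmain) (Real.exp_pos _)
  -- The smallness of M r lets half of S be absorbed into the left side.
  have j1 : 2 * B * B * (r * S * M) ≤ 1 / 2 * S := by
    have := mul_le_mul_of_nonneg_right hBMr hS0
    nlinarith
  have j2 : 2 * B * B * (Δ * (C * r) * M) ≤ 2 * B * B * (Δ * C) := by
    have : Δ * C * (M * r) ≤ Δ * C * 1 := by gcongr
    have := mul_le_mul_of_nonneg_left this (show 0 ≤ 2 * B * B by positivity)
    linarith
  have hSfin : S ≤ 2 * (B * (‖a‖ + 1) + 2 * B ^ 2 * C * (1 / (2 * κ) + 1)) * Δ := by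
    have e : Δ * C / (2 * κ) = Δ * C * (1 / (2 * κ)) := by ring
    rw [e] at hSle
    nlinarith
  refine (hbound x hx).trans ?_
  gcongr

end IsDichotomyPair

/-! ### Outgoing defects of the decaying, growing and perturbed solutions -/

namespace IsDichotomyPair

variable {V : ℝ → ℝ} {E κ B : ℝ} {u v : ℝ → ℂ}

theorem norm_outPlus_v_le (h : IsDichotomyPair V E κ B u v) (hE : 0 ≤ E) {M : ℝ} (hM : 0 ≤ M) :
    ‖outPlus E v M‖ ≤ (1 + Real.sqrt E) * B * Real.exp (κ * M) := by
  rw [outPlus, csqrt_ofReal hE]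
  refine (_root_.norm_sub_le _ _).trans ?_
  rw [norm_mul, norm_mul, Complex.norm_I, one_mul, Complex.norm_real, Real.norm_eq_abs,
    abs_of_nonneg (Real.sqrt_nonneg E)]
  nlinarith [h.dv_le M hM, mul_le_mul_of_nonneg_left (h.v_le M hM) (Real.sqrt_nonneg E)]

theorem norm_outPlus_u_le (h : IsDichotomyPair V E κ B u v) (hE : 0 ≤ E) {M : ℝ} (hM : 0 ≤ M) :
    ‖outPlus E u M‖ ≤ (1 + Real.sqrt E) * B * Real.exp (-κ * M) := by
  rw [outPlus, csqrt_ofReal hE]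
  refine (_root_.norm_sub_le _ _).trans ?_
  rw [norm_mul, norm_mul, Complex.norm_I, one_mul, Complex.norm_real, Real.norm_eq_abs,
    abs_of_nonneg (Real.sqrt_nonneg E)]
  nlinarith [h.du_le M hM, mul_le_mul_of_nonneg_left (h.u_le M hM) (Real.sqrt_nonneg E)]

/-- Decay of u cancels growth of v, so the integrand is only bounded; this is one source of the
factor M in the error. -/
theorem norm_integral_mul_le (h : IsDichotomyPair V E κ B u v) {M : ℝ} (hM : 0 ≤ M) :
    ‖∫ t in (0 : ℝ)..M, u t * v t‖ ≤ B ^ 2 * M := by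
  have hB := h.bound_nonneg
  have := intervalIntegral.norm_integral_le_of_norm_le_const (a := 0) (b := M) (C := B ^ 2)
    (f := fun t => u t * v t) (fun t ht => by
      rw [Set.uIoc_of_le hM] at ht
      rw [norm_mul]
      calc _ ≤ B * Real.exp (-κ * t) * (B * Real.exp (κ * t)) :=
            mul_le_mul (h.u_le t ht.1.le) (h.v_le t ht.1.le) (norm_nonneg _) (by positivity)
        _ = B ^ 2 * (Real.exp (-κ * t) * Real.exp (κ * t)) := by ring
        _ = B ^ 2 := by rw [← Real.exp_add, show -κ * t + κ * t = 0 by ring]; simp)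
  rwa [sub_zero, abs_of_nonneg hM] at this

/-- The outgoing defect at `M` is, up to a small Lipschitz error, affine in the energy and in the
initial data. -/
theorem exists_outPlus_lipschitz (h : IsDichotomyPair V E κ B u v) (hE : 0 < E) (a : ℂ) :
    ∃ C, 0 < C ∧ ∃ ε, 0 < ε ∧ ∀ M r : ℝ, 1 ≤ M → 0 ≤ r → M * r ≤ ε →
      ∀ (z₁ z₂ δ₁ δ₂ : ℂ) (f₁ f₂ : ℝ → ℂ), ‖z₁ - E‖ ≤ r → ‖z₂ - E‖ ≤ r → ‖δ₂‖ ≤ r →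
        IsSchrodingerSolution V z₁ f₁ → HasCombinedData u v a δ₁ f₁ →
        IsSchrodingerSolution V z₂ f₂ → HasCombinedData u v a δ₂ f₂ →
        ‖outPlus z₁ f₁ M - outPlus z₂ f₂ M
            - outPlus E v M * ((δ₁ - δ₂) - (z₁ - z₂) * ∫ t in (0 : ℝ)..M, u t ^ 2)‖
          ≤ C * (M * (Real.exp (-κ * M) + r * Real.exp (κ * M)))
            * (‖δ₁ - δ₂‖ + ‖z₁ - z₂‖) := by
  have hκ := h.pos
  have hB := h.bound_nonneg
  set s := Real.sqrt (E / 2) with hs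
  have hs0 : 0 < s := Real.sqrt_pos.2 (by linarith)
  set b := (1 + Real.sqrt E) * B with hb
  have hb0 : 0 ≤ b := by positivity
  -- `norm_sub_le` is used twice: K₁ compares f₂ with u, C₀ is the resulting size constant of f₂,
  -- and K₂ compares f₁ with f₂ using C₀.
  set K₁ := 2 * (B * (‖a‖ + 1) + 2 * B ^ 2 * B * (1 / (2 * κ) + 1)) with hK₁
  have hK₁0 : 0 ≤ K₁ := by positivity
  set C₀ := B + 2 * K₁ with hC₀
  have hC₀0 : 0 ≤ C₀ := by positivity
  set K₂ := 2 * (B * (‖a‖ + 1) + 2 * B ^ 2 * C₀ * (1 / (2 * κ) + 1)) with hK₂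
  have hK₂0 : 0 ≤ K₂ := by positivity
  -- In the smallness threshold, E/2 keeps both energies in Re z ≥ E/2, where the square root is
  -- Lipschitz, and 1/(4B² + 1) permits the absorption in `norm_sub_le`.
  refine ⟨‖a‖ * b + b * B ^ 2 + 2 * b * B * (K₂ + 2 * K₁) + K₂ / s + C₀ / s + 1, by positivity,
    min (min 1 (E / 2)) (1 / (4 * B ^ 2 + 1)), by positivity, ?_⟩
  intro M r hM hr hMr z₁ z₂ δ₁ δ₂ f₁ f₂ hz₁ hz₂ hδ₂ hf₁ hd₁ hf₂ hd₂
  have hM0 : 0 ≤ M := by linarith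
  have hMr1 : M * r ≤ 1 := hMr.trans ((min_le_left _ _).trans (min_le_left _ _))
  have hrE : r ≤ E / 2 := by
    have : M * r ≤ E / 2 := hMr.trans ((min_le_left _ _).trans (min_le_right _ _))
    exact (le_mul_of_one_le_left hr hM).trans this
  have hBMr : 4 * B ^ 2 * (M * r) ≤ 1 := by
    have h1 : M * r ≤ 1 / (4 * B ^ 2 + 1) := hMr.trans (min_le_right _ _)
    rw [le_div_iff₀ (by positivity)] at h1
    have : 0 ≤ M * r := by positivity
    linarith
  set Δ := ‖δ₁ - δ₂‖ + ‖z₁ - z₂‖ with hΔ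
  have hΔ0 : 0 ≤ Δ := by positivity
  have hδΔ : ‖δ₁ - δ₂‖ ≤ Δ := by rw [hΔ]; linarith [norm_nonneg (z₁ - z₂)]
  have hzΔ : ‖z₁ - z₂‖ ≤ Δ := by rw [hΔ]; linarith [norm_nonneg (δ₁ - δ₂)]
  have hdu : HasCombinedData u v a 0 u := by simp [HasCombinedData]
  have hf₂u : ∀ t ∈ Set.Icc 0 M, ‖f₂ t - u t‖ ≤ 2 * K₁ * r * Real.exp (κ * t) := by
    intro t ht
    have := h.norm_sub_le hB hM0 hMr1 hBMr hr hz₂ hf₂ hd₂ h.sol_u hdu (fun t ht => by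
      have : 0 ≤ B * (r * Real.exp (κ * t)) := by positivity
      linarith [h.u_le t ht.1]) ht
    refine this.trans ?_
    rw [sub_zero, ← hK₁]
    have : ‖δ₂‖ + ‖z₂ - E‖ ≤ 2 * r := by linarith
    calc _ ≤ K₁ * (2 * r) * Real.exp (κ * t) := by gcongr
      _ = _ := by ring
  have hf₂b : ∀ t ∈ Set.Icc 0 M, ‖f₂ t‖ ≤ C₀ * (Real.exp (-κ * t) + r * Real.exp (κ * t)) := by
    intro t ht
    have h1 := hf₂u t ht
    have h2 := h.u_le t ht.1
    have h3 : ‖f₂ t‖ ≤ ‖f₂ t - u t‖ + ‖u t‖ := by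
      simpa using norm_add_le (f₂ t - u t) (u t)
    have h4 : 0 ≤ B * (r * Real.exp (κ * t)) := by positivity
    have h5 : 0 ≤ 2 * K₁ * Real.exp (-κ * t) := by positivity
    rw [hC₀]
    linarith
  have hD : ∀ t ∈ Set.Icc 0 M, ‖f₁ t - f₂ t‖ ≤ K₂ * Δ * Real.exp (κ * t) := fun t ht =>
    h.norm_sub_le hC₀0 hM0 hMr1 hBMr hr hz₁ hf₁ hd₁ hf₂ hd₂ hf₂b ht
  have hA := h.norm_outPlus_v_le hE.le hM0
  have hBp := h.norm_outPlus_u_le hE.le hM0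
  set A := outPlus E v M with hAdef
  set Bp := outPlus E u M with hBdef
  have hcu := h.sol_u.continuous
  have hcv := h.sol_v.continuous
  have hcf₁ := hf₁.continuous
  have hcf₂ := hf₂.continuous
  -- Once f₂ is replaced by u in the (z₁ - z₂) term, J collects what is of second order: every
  -- summand carries both r and Δ.
  set J := ∫ t in (0 : ℝ)..M, (A * u t - Bp * v t) * ((z₁ - E) * (f₁ t - f₂ t)
    + (z₁ - z₂) * (f₂ t - u t)) with hJ
  have hJb : ‖J‖ ≤ 2 * b * B * (K₂ + 2 * K₁) * (M * (r * Real.exp (κ * M))) * Δ := by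
    have := h.norm_kernel_integral_le hM0 hA hBp (G₁ := 0) (G₂ := r * (K₂ * Δ) + Δ * (2 * K₁ * r))
      le_rfl (g := fun t => (z₁ - E) * (f₁ t - f₂ t) + (z₁ - z₂) * (f₂ t - u t)) (fun t ht => by
        refine (norm_add_le _ _).trans ?_
        rw [norm_mul, norm_mul]
        have e1 : ‖z₁ - E‖ * ‖f₁ t - f₂ t‖ ≤ r * (K₂ * Δ * Real.exp (κ * t)) :=
          mul_le_mul hz₁ (hD t ht) (norm_nonneg _) hr
        have e2 : ‖z₁ - z₂‖ * ‖f₂ t - u t‖ ≤ Δ * (2 * K₁ * r * Real.exp (κ * t)) :=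
          mul_le_mul hzΔ (hf₂u t ht) (norm_nonneg _) hΔ0
        linarith)
    refine this.trans (le_of_eq ?_)
    ring
  have hrep := h.integral_representation_sub hf₁ hd₁ hf₂ hd₂ 1 (-(Complex.I * csqrt E)) M
  have hAe : 1 * deriv v M + -(Complex.I * csqrt E) * v M = A := by rw [hAdef, outPlus]; ring
  have hBe : 1 * deriv u M + -(Complex.I * csqrt E) * u M = Bp := by rw [hBdef, outPlus]; ring
  rw [hAe, hBe] at hrep
  have hsplit : ∫ t in (0 : ℝ)..M, (A * u t - Bp * v t) * ((z₁ - E) * (f₁ t - f₂ t)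
      + (z₁ - z₂) * f₂ t) = J + (z₁ - z₂) * (A * (∫ t in (0 : ℝ)..M, u t ^ 2)
        - Bp * ∫ t in (0 : ℝ)..M, u t * v t) := by
    rw [hJ, ← intervalIntegral.integral_const_mul A, ← intervalIntegral.integral_const_mul Bp,
      ← intervalIntegral.integral_sub (Continuous.intervalIntegrable (by fun_prop) _ _)
        (Continuous.intervalIntegrable (by fun_prop) _ _),
      ← intervalIntegral.integral_const_mul,
      ← intervalIntegral.integral_add (Continuous.intervalIntegrable (by fun_prop) _ _)
        (Continuous.intervalIntegrable (by fun_prop) _ _)]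
    exact intervalIntegral.integral_congr fun t _ => by ring
  rw [hsplit] at hrep
  have hid : outPlus z₁ f₁ M - outPlus z₂ f₂ M
      - A * ((δ₁ - δ₂) - (z₁ - z₂) * ∫ t in (0 : ℝ)..M, u t ^ 2)
      = a * (δ₁ - δ₂) * Bp + (z₁ - z₂) * Bp * (∫ t in (0 : ℝ)..M, u t * v t) - J
        - Complex.I * (csqrt z₁ - csqrt E) * (f₁ M - f₂ M)
        - Complex.I * (csqrt z₁ - csqrt z₂) * f₂ M := by
    simp only [outPlus]
    linear_combination hrep
  have hre : ∀ z : ℂ, ‖z - E‖ ≤ r → E / 2 ≤ z.re := by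
    intro z hz
    have h1 := (Complex.abs_re_le_norm (z - E)).trans (hz.trans hrE)
    rw [Complex.sub_re, Complex.ofReal_re, abs_le] at h1
    linarith [h1.1]
  have hE2 : (0 : ℝ) < E / 2 := by linarith
  have q1 : ‖csqrt z₁ - csqrt E‖ ≤ r / s :=
    (norm_csqrt_sub_le hE2 (hre _ hz₁) (by rw [Complex.ofReal_re]; linarith)).trans (by gcongr)
  have q2 : ‖csqrt z₁ - csqrt z₂‖ ≤ Δ / s :=
    (norm_csqrt_sub_le hE2 (hre _ hz₁) (hre _ hz₂)).trans (by gcongr)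
  have hMm : M ∈ Set.Icc 0 M := ⟨hM0, le_rfl⟩
  set em := Real.exp (-κ * M) with hem
  set ep := Real.exp (κ * M) with hep
  have hem0 : 0 < em := Real.exp_pos _
  have hep0 : 0 < ep := Real.exp_pos _
  have t1 : ‖a * (δ₁ - δ₂) * Bp‖ ≤ ‖a‖ * Δ * (b * em) := by
    rw [norm_mul, norm_mul]
    exact mul_le_mul (by gcongr) hBp (norm_nonneg _) (by positivity)
  have t2 : ‖(z₁ - z₂) * Bp * (∫ t in (0 : ℝ)..M, u t * v t)‖ ≤ Δ * (b * em) * (B ^ 2 * M) := by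
    rw [norm_mul, norm_mul]
    exact mul_le_mul (mul_le_mul hzΔ hBp (norm_nonneg _) hΔ0) (h.norm_integral_mul_le hM0)
      (norm_nonneg _) (by positivity)
  have t3 : ‖Complex.I * (csqrt z₁ - csqrt E) * (f₁ M - f₂ M)‖ ≤ r / s * (K₂ * Δ * ep) := by
    rw [norm_mul, norm_mul, Complex.norm_I, one_mul]
    exact mul_le_mul q1 (hD M hMm) (norm_nonneg _) (by positivity)
  have t4 : ‖Complex.I * (csqrt z₁ - csqrt z₂) * f₂ M‖ ≤ Δ / s * (C₀ * (em + r * ep)) := by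
    rw [norm_mul, norm_mul, Complex.norm_I, one_mul]
    exact mul_le_mul q2 (hf₂b M hMm) (norm_nonneg _) (by positivity)
  rw [hid]
  have hsum := (_root_.norm_sub_le _ _).trans (add_le_add_left ((_root_.norm_sub_le _ _).trans
    (add_le_add_left ((_root_.norm_sub_le _ _).trans (add_le_add_left (norm_add_le
      (a * (δ₁ - δ₂) * Bp) ((z₁ - z₂) * Bp * (∫ t in (0 : ℝ)..M, u t * v t))) ‖J‖))
      ‖Complex.I * (csqrt z₁ - csqrt E) * (f₁ M - f₂ M)‖))
      ‖Complex.I * (csqrt z₁ - csqrt z₂) * f₂ M‖)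
  refine hsum.trans ?_
  have hre0 : 0 ≤ r * ep := by positivity
  have w5 : em + r * ep ≤ M * (em + r * ep) := le_mul_of_one_le_left (by positivity) hM
  have w1 : em ≤ M * (em + r * ep) := (le_add_of_nonneg_right hre0).trans w5
  have w2 : M * em ≤ M * (em + r * ep) := by gcongr; linarith
  have w3 : M * (r * ep) ≤ M * (em + r * ep) := by gcongr; linarith
  have w4 : r * ep ≤ M * (em + r * ep) := (le_add_of_nonneg_left hem0.le).trans w5
  have y1 := mul_le_mul_of_nonneg_left w1 (show 0 ≤ ‖a‖ * b * Δ by positivity)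
  have y2 := mul_le_mul_of_nonneg_left w2 (show 0 ≤ b * B ^ 2 * Δ by positivity)
  have y3 := mul_le_mul_of_nonneg_left w3 (show 0 ≤ 2 * b * B * (K₂ + 2 * K₁) * Δ by positivity)
  have y4 := mul_le_mul_of_nonneg_left w4 (show 0 ≤ K₂ / s * Δ by positivity)
  have y5 := mul_le_mul_of_nonneg_left w5 (show 0 ≤ C₀ / s * Δ by positivity)
  have y6 : 0 ≤ M * (em + r * ep) * Δ := by positivity
  have x3 : r / s * (K₂ * Δ * ep) = K₂ / s * Δ * (r * ep) := by ring
  have x4 : Δ / s * (C₀ * (em + r * ep)) = C₀ / s * Δ * (em + r * ep) := by ring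
  rw [x3] at t3
  rw [x4] at t4
  linarith

/-- The outgoing defect of a real growing solution is bounded below. -/
theorem exp_le_norm_outPlus_v (h : IsDichotomyPair V E κ B u v) (hE : 0 < E) {M : ℝ} (hM : 0 ≤ M)
    (hv : (v M).im = 0) (hdv : (deriv v M).im = 0) :
    Real.exp (κ * M) ≤ B * (1 + 1 / Real.sqrt E) * ‖outPlus E v M‖ := by
  have hs : 0 < Real.sqrt E := Real.sqrt_pos.2 hE
  have hB := h.bound_nonneg
  -- For real v the derivative and the value sit in the real and imaginary parts of the defect, so
  -- neither can hide by cancellation. The unit Wronskian with the decaying u then forces one of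
  -- them to be large.
  have hre : (outPlus E v M).re = (deriv v M).re := by
    simp [outPlus, csqrt_ofReal hE.le, hv]
  have him : (outPlus E v M).im = -(Real.sqrt E * (v M).re) := by
    simp [outPlus, csqrt_ofReal hE.le, hv, hdv]
  have n1 : ‖deriv v M‖ ≤ ‖outPlus E v M‖ := by
    have : deriv v M = ((deriv v M).re : ℂ) := Complex.ext (by simp) (by simpa using hdv)
    rw [this, Complex.norm_real, ← hre]
    exact Complex.abs_re_le_norm _
  have n2 : ‖v M‖ ≤ 1 / Real.sqrt E * ‖outPlus E v M‖ := by
    have : v M = ((v M).re : ℂ) := Complex.ext (by simp) (by simpa using hv)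
    rw [this, Complex.norm_real, one_div, le_inv_mul_iff₀ hs]
    have h2 := Complex.abs_im_le_norm (outPlus E v M)
    rwa [him, abs_neg, abs_mul, abs_of_pos hs] at h2
  have hW := h.sol_u.wronskian_eq h.sol_v 0 M
  rw [h.wronskian] at hW
  have h1 : 1 ≤ ‖u M‖ * ‖deriv v M‖ + ‖deriv u M‖ * ‖v M‖ := by
    rw [← norm_mul, ← norm_mul, ← norm_one (α := ℂ), ← hW]
    exact _root_.norm_sub_le _ _
  have e : Real.exp (-κ * M) * Real.exp (κ * M) = 1 := by
    rw [← Real.exp_add, show -κ * M + κ * M = 0 by ring, Real.exp_zero]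
  have h2 : 1 ≤ B * Real.exp (-κ * M) * ((1 + 1 / Real.sqrt E) * ‖outPlus E v M‖) := by
    refine h1.trans ?_
    rw [add_mul 1, mul_add, one_mul]
    exact add_le_add (mul_le_mul (h.u_le M hM) n1 (norm_nonneg _) (by positivity))
      (mul_le_mul (h.du_le M hM) n2 (norm_nonneg _) (by positivity))
  calc Real.exp (κ * M) = 1 * Real.exp (κ * M) := (one_mul _).symm
    _ ≤ B * Real.exp (-κ * M) * ((1 + 1 / Real.sqrt E) * ‖outPlus E v M‖) * Real.exp (κ * M) := by
        gcongr
    _ = B * (1 + 1 / Real.sqrt E) * ‖outPlus E v M‖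
          * (Real.exp (-κ * M) * Real.exp (κ * M)) := by ring
    _ = _ := by rw [e, mul_one]

end IsDichotomyPair

/-! ### A quantitative Newton argument -/

/-- The map x ↦ η - s - P x sends Ω into the ball of radius r/4 + r/4 = r/2 and contracts by 1/4. Ω
is only required to lie between two balls, since the Euclidean ball has to be handled in the sup
norm of the product. -/
theorem exists_fixedPoint_near {X : Type*} [NormedAddCommGroup X] [CompleteSpace X] {Ω : Set X}
    (hΩ : IsClosed Ω) {η s : X} {P : X → X} {r : ℝ} (hin : ∀ x, ‖x - η‖ ≤ r / 2 → x ∈ Ω)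
    (hout : ∀ x ∈ Ω, ‖x - η‖ ≤ r) (hP : ∀ x ∈ Ω, ∀ y ∈ Ω, ‖P x - P y‖ ≤ 1 / 4 * ‖x - y‖)
    (hPη : P η = 0) (hs : ‖s‖ ≤ r / 4) :
    ∃ x ∈ Ω, x = η - s - P x ∧ ‖x - η‖ ≤ 2 * ‖s‖ ∧ ∀ y ∈ Ω, y = η - s - P y → y = x := by
  have hr : 0 ≤ r := by linarith [norm_nonneg s]
  have hη : η ∈ Ω := hin η (by rw [sub_self, norm_zero]; linarith)
  have hPb : ∀ x ∈ Ω, ‖P x‖ ≤ 1 / 4 * ‖x - η‖ := fun x hx => by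
    simpa [hPη] using hP x hx η hη
  set N : X → X := fun x => η - s - P x with hN
  have hdiff : ∀ x, N x - η = -s - P x := fun x => by simp only [hN]; abel
  have hmaps : Set.MapsTo N Ω Ω := fun x hx => hin _ (by
    rw [hdiff]
    refine (norm_sub_le _ _).trans ?_
    rw [norm_neg]
    linarith [hPb x hx, hout x hx])
  have hcontr : ContractingWith (1 / 4) (hmaps.restrict N Ω Ω) := by
    refine ⟨by norm_num, LipschitzWith.of_dist_le_mul fun x y => ?_⟩
    rw [Subtype.dist_eq, Subtype.dist_eq, dist_eq_norm, dist_eq_norm,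
      Set.MapsTo.val_restrict_apply, Set.MapsTo.val_restrict_apply,
      show N x - N y = -(P x - P y) by simp only [hN]; abel, norm_neg]
    simpa using hP x x.2 y y.2
  obtain ⟨x, hx, hfix, -⟩ := hcontr.exists_fixedPoint' hΩ.isComplete hmaps hη (edist_ne_top _ _)
  have hfix' : x = N x := hfix.symm
  refine ⟨x, hx, hfix', ?_, fun y hy hfy => ?_⟩
  · have h1 : ‖x - η‖ ≤ ‖s‖ + 1 / 4 * ‖x - η‖ := by
      conv_lhs => rw [hfix', hdiff]
      refine (norm_sub_le _ _).trans ?_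
      rw [norm_neg]
      linarith [hPb x hx]
    linarith [norm_nonneg s]
  · have h1 : y - x = -(P y - P x) := by
      calc y - x = N y - N x := by rw [← hfix', ← show y = N y from hfy]
        _ = _ := by simp only [hN]; abel
    have h2 : ‖y - x‖ ≤ 1 / 4 * ‖y - x‖ := by
      conv_lhs => rw [h1, norm_neg]
      exact hP y hy x hx
    exact sub_eq_zero.1 (norm_le_zero_iff.1 (by linarith))

/-- The inverse of the linear map `(w, z) ↦ (w - z I₊, w + z I₋)`. -/
noncomputable def linearizedInverse (Ip Im : ℂ) (g : ℂ × ℂ) : ℂ × ℂ :=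
  ((Im * g.1 + Ip * g.2) / (Im + Ip), (g.2 - g.1) / (Im + Ip))

theorem linearizedInverse_sub (Ip Im : ℂ) (g g' : ℂ × ℂ) :
    linearizedInverse Ip Im (g - g') = linearizedInverse Ip Im g - linearizedInverse Ip Im g' := by
  ext <;> simp only [linearizedInverse, Prod.fst_sub, Prod.snd_sub] <;> ring

theorem linearizedInverse_apply {Ip Im : ℂ} (hI : Im + Ip ≠ 0) (x : ℂ × ℂ) :
    linearizedInverse Ip Im (x.1 - x.2 * Ip, x.1 + x.2 * Im) = x := by
  ext <;> simp only [linearizedInverse] <;> field_simp <;> ring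

theorem linearizedInverse_eq_zero {Ip Im : ℂ} (hI : Im + Ip ≠ 0) {g : ℂ × ℂ}
    (h : linearizedInverse Ip Im g = 0) : g = 0 := by
  have h1 := congrArg Prod.fst h
  have h2 := congrArg Prod.snd h
  simp only [linearizedInverse, Prod.fst_zero, Prod.snd_zero, div_eq_zero_iff, hI, or_false,
    sub_eq_zero] at h1 h2
  rw [h2, ← add_mul] at h1
  have h3 := (mul_eq_zero.1 h1).resolve_left hI
  exact Prod.ext h3 (h2.trans h3)

theorem norm_linearizedInverse_le {Ip Im : ℂ} {β c : ℝ} (hc : 0 < c) (hI : c ≤ ‖Im + Ip‖)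
    (hIp : ‖Ip‖ ≤ β) (hIm : ‖Im‖ ≤ β) (g : ℂ × ℂ) :
    ‖linearizedInverse Ip Im g‖ ≤ 2 * (β + 1) / c * ‖g‖ := by
  have hβ : 0 ≤ β := (norm_nonneg _).trans hIp
  have h1 := norm_fst_le g
  have h2 := norm_snd_le g
  have hg := norm_nonneg g
  have key : ∀ x : ℂ, ‖x‖ ≤ 2 * (β + 1) * ‖g‖ → ‖x / (Im + Ip)‖ ≤ 2 * (β + 1) / c * ‖g‖ := by
    intro x hx
    rw [norm_div, div_mul_eq_mul_div]
    exact div_le_div₀ (by positivity) hx hc hI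
  refine max_le (key _ ((norm_add_le _ _).trans ?_)) (key _ ((norm_sub_le _ _).trans ?_))
  · rw [norm_mul, norm_mul]
    have := mul_le_mul hIm h1 (norm_nonneg _) hβ
    have := mul_le_mul hIp h2 (norm_nonneg _) hβ
    nlinarith
  · nlinarith

/-- Zeros of a map that is affine up to a small Lipschitz error. -/
theorem exists_zero_of_approx_affine {T : ℂ × ℂ → ℂ × ℂ} {Ap Am Ip Im : ℂ} {η : ℂ × ℂ}
    {Ω : Set (ℂ × ℂ)} {K q γ r : ℝ} (hAp : Ap ≠ 0) (hAm : Am ≠ 0) (hI : Im + Ip ≠ 0)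
    (hK0 : 0 ≤ K) (hK : ∀ g, ‖linearizedInverse Ip Im g‖ ≤ K * ‖g‖) (hΩ : IsClosed Ω)
    (hin : ∀ x, ‖x - η‖ ≤ r / 2 → x ∈ Ω) (hout : ∀ x ∈ Ω, ‖x - η‖ ≤ r)
    (hp : ∀ x ∈ Ω, ∀ y ∈ Ω, ‖(T x).1 - (T y).1 - Ap * ((x.1 - y.1) - (x.2 - y.2) * Ip)‖
      ≤ q * ‖x - y‖ * ‖Ap‖)
    (hm : ∀ x ∈ Ω, ∀ y ∈ Ω, ‖(T x).2 - (T y).2 - Am * ((x.1 - y.1) + (x.2 - y.2) * Im)‖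
      ≤ q * ‖x - y‖ * ‖Am‖)
    (hq : K * q ≤ 1 / 4) (hγp : ‖(T η).1‖ ≤ γ * ‖Ap‖) (hγm : ‖(T η).2‖ ≤ γ * ‖Am‖)
    (hγ : K * γ ≤ r / 4) :
    ∃ x ∈ Ω, T x = 0 ∧ (∀ y ∈ Ω, T y = 0 → y = x) ∧ ‖x - η‖ ≤ 2 * (K * γ) ∧
      ∀ q', ‖(T x).1 - (T η).1 - Ap * ((x.1 - η.1) - (x.2 - η.2) * Ip)‖ ≤ q' * ‖Ap‖ →
        ‖(T x).2 - (T η).2 - Am * ((x.1 - η.1) + (x.2 - η.2) * Im)‖ ≤ q' * ‖Am‖ →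
        ‖x - (η - linearizedInverse Ip Im ((T η).1 / Ap, (T η).2 / Am))‖ ≤ K * q' := by
  set G : ℂ × ℂ → ℂ × ℂ := fun x => ((T x).1 / Ap, (T x).2 / Am) with hG
  -- P is the nonlinear defect of G, pulled back by the inverse of the linear model; zeros of T are
  -- the fixed points of x ↦ η - L⁻¹G(η) - P x.
  set P : ℂ × ℂ → ℂ × ℂ := fun x => linearizedInverse Ip Im (G x - G η) - (x - η) with hP
  have hPsub : ∀ x y, P x - P y = linearizedInverse Ip Im
      (G x - G y - ((x - y).1 - (x - y).2 * Ip, (x - y).1 + (x - y).2 * Im)) := by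
    intro x y
    rw [linearizedInverse_sub, linearizedInverse_apply hI, linearizedInverse_sub]
    simp only [hP, linearizedInverse_sub]
    abel
  have hPle : ∀ x y q', ‖(T x).1 - (T y).1 - Ap * ((x.1 - y.1) - (x.2 - y.2) * Ip)‖ ≤ q' * ‖Ap‖ →
      ‖(T x).2 - (T y).2 - Am * ((x.1 - y.1) + (x.2 - y.2) * Im)‖ ≤ q' * ‖Am‖ →
      ‖P x - P y‖ ≤ K * q' := by
    intro x y q' h1 h2
    rw [hPsub]
    refine (hK _).trans (mul_le_mul_of_nonneg_left (max_le ?_ ?_) hK0)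
    · rw [← mul_le_mul_iff_left₀ (norm_pos_iff.2 hAp), ← norm_mul]
      refine le_of_eq_of_le (congrArg norm ?_) h1
      simp only [hG, Prod.fst_sub, Prod.snd_sub]
      field_simp
    · rw [← mul_le_mul_iff_left₀ (norm_pos_iff.2 hAm), ← norm_mul]
      refine le_of_eq_of_le (congrArg norm ?_) h2
      simp only [hG, Prod.fst_sub, Prod.snd_sub]
      field_simp
  have hPη : P η = 0 := by simp [hP, linearizedInverse]
  have hfix : ∀ x, x = η - linearizedInverse Ip Im (G η) - P x ↔ T x = 0 := by
    intro x
    have e : η - linearizedInverse Ip Im (G η) - P x = x - linearizedInverse Ip Im (G x) := by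
      simp only [hP, linearizedInverse_sub]
      abel
    rw [e, eq_comm, sub_eq_self]
    constructor
    · intro h
      have h0 := linearizedInverse_eq_zero hI h
      have h1 := congrArg Prod.fst h0
      have h2 := congrArg Prod.snd h0
      simp only [hG, Prod.fst_zero, Prod.snd_zero, div_eq_zero_iff, hAp, hAm, or_false] at h1 h2
      exact Prod.ext h1 h2
    · intro h
      simp [hG, h, linearizedInverse]
  have hs : ‖linearizedInverse Ip Im (G η)‖ ≤ K * γ := by
    refine (hK _).trans (mul_le_mul_of_nonneg_left (max_le ?_ ?_) hK0)
    · simp only [hG]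
      rwa [norm_div, div_le_iff₀ (norm_pos_iff.2 hAp)]
    · simp only [hG]
      rwa [norm_div, div_le_iff₀ (norm_pos_iff.2 hAm)]
  obtain ⟨x, hx, hxe, hxη, huniq⟩ := exists_fixedPoint_near hΩ hin hout (P := P)
    (fun x hx y hy => (hPle x y _ (hp x hx y hy) (hm x hx y hy)).trans (by
      rw [← mul_assoc]
      exact mul_le_mul_of_nonneg_right hq (norm_nonneg _))) hPη (hs.trans hγ)
  refine ⟨x, hx, (hfix x).1 hxe, fun y hy hTy => huniq y hy ((hfix y).2 hTy), by linarith, ?_⟩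
  -- The root misses the first Newton step by exactly P x. Keeping q' free allows a sharper estimate
  -- at the actual distance from η than the uniform one on Ω.
  intro q' h1 h2
  have h3 := hPle x η q' h1 h2
  rw [hPη, sub_zero] at h3
  have : x - (η - linearizedInverse Ip Im (G η)) = -P x := by
    nth_rewrite 1 [hxe]
    abel
  rwa [this, norm_neg]

/-! ### Resonances -/

theorem hasDerivAt_ite_le {f g f' g' : ℝ → ℂ} {a : ℝ} (hf : ∀ x, HasDerivAt f (f' x) x)
    (hg : ∀ x, HasDerivAt g (g' x) x) (h0 : f a = g a) (h1 : f' a = g' a) (x : ℝ) :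
    HasDerivAt (fun x => if x ≤ a then f x else g x) (if x ≤ a then f' x else g' x) x := by
  rcases lt_trichotomy x a with h | rfl | h
  · rw [if_pos h.le]
    refine (hf x).congr_of_eventuallyEq ?_
    filter_upwards [gt_mem_nhds h] with t ht using if_pos ht.le
  · rw [if_pos le_rfl]
    have hl : HasDerivWithinAt (fun t => if t ≤ x then f t else g t) (f' x) (Set.Iic x) x :=
      (hf x).hasDerivWithinAt.congr (fun t ht => if_pos ht) (if_pos le_rfl)
    have hr : HasDerivWithinAt (fun t => if t ≤ x then f t else g t) (f' x) (Set.Ici x) x := by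
      rw [h1]
      refine (hg x).hasDerivWithinAt.congr (fun t ht => ?_) (by rw [if_pos le_rfl, h0])
      rcases eq_or_lt_of_le (show x ≤ t from ht) with rfl | h
      · rw [if_pos le_rfl, h0]
      · exact if_neg (not_le.2 h)
    have := hl.union hr
    rwa [Set.Iic_union_Ici, hasDerivWithinAt_univ] at this
  · rw [if_neg (not_le.2 h)]
    refine (hg x).congr_of_eventuallyEq ?_
    filter_upwards [lt_mem_nhds h] with t ht using if_neg (not_le.2 ht)

theorem continuous_ite_le {f g : ℝ → ℂ} {a : ℝ} (hf : Continuous f) (hg : Continuous g)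
    (h0 : f a = g a) : Continuous fun x => if x ≤ a then f x else g x :=
  hf.if_le hg continuous_id continuous_const fun x hx => by
    have : x = a := hx
    rw [this, h0]

theorem hasDerivAt_exp_mul (c α : ℂ) (x : ℝ) :
    HasDerivAt (fun x : ℝ => c * Complex.exp (α * x)) (c * α * Complex.exp (α * x)) x := by
  have h : HasDerivAt (fun x : ℝ => α * (x : ℂ)) α x := by
    simpa using (Complex.ofRealCLM.hasDerivAt (x := x)).const_mul α
  exact (h.cexp.const_mul c).congr_deriv (by ring)

/-- An outgoing solution on `[-M, M]` extends to an outgoing solution of the truncated equation. -/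
theorem exists_outgoing_extension {V : ℝ → ℝ} {z : ℂ} {f : ℝ → ℂ} {M : ℝ} (hM : 0 < M)
    (hf : IsSchrodingerSolution V z f) (hne : f 0 ≠ 0 ∨ deriv f 0 ≠ 0)
    (hp : outPlus z f M = 0) (hm : outMinus z f M = 0) :
    ∃ ψ : ℝ → ℂ, ψ ≠ 0 ∧ ContDiff ℝ 1 ψ ∧
    (∀ x : ℝ, |x| ≠ M → HasDerivAt (deriv ψ) (((Vtrunc V M x : ℂ) - z) * ψ x) x) ∧
    (∃ c : ℂ, ∀ x : ℝ, M ≤ x → ψ x = c * Complex.exp (Complex.I * csqrt z * x)) ∧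
    (∃ c : ℂ, ∀ x : ℝ, x ≤ -M → ψ x = c * Complex.exp (-(Complex.I * csqrt z * x))) := by
  set α := Complex.I * csqrt z with hα
  have hα2 : α * α = -z := by
    rw [hα]
    linear_combination Complex.I * Complex.I * csqrt_sq z + z * Complex.I_mul_I
  rw [outPlus, ← hα] at hp
  rw [outMinus, ← hα] at hm
  set cp := f M * Complex.exp (-(α * M)) with hcp
  set cm := f (-M) * Complex.exp (-(α * M)) with hcm
  have hep : cp * Complex.exp (α * M) = f M := by
    rw [hcp, mul_assoc, ← Complex.exp_add, neg_add_cancel, Complex.exp_zero, mul_one]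
  have hem : cm * Complex.exp (-α * (-M : ℝ)) = f (-M) := by
    rw [hcm, mul_assoc, ← Complex.exp_add]
    push_cast
    rw [show -(α * (M : ℂ)) + -α * -(M : ℂ) = 0 by ring, Complex.exp_zero, mul_one]
  set gp : ℝ → ℂ := fun x => cp * Complex.exp (α * x) with hgp
  set gp' : ℝ → ℂ := fun x => cp * α * Complex.exp (α * x) with hgp'
  set gm : ℝ → ℂ := fun x => cm * Complex.exp (-α * x) with hgm
  set gm' : ℝ → ℂ := fun x => cm * -α * Complex.exp (-α * x) with hgm'
  set φ : ℝ → ℂ := fun x => if x ≤ M then f x else gp x with hφ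
  set φ' : ℝ → ℂ := fun x => if x ≤ M then deriv f x else gp' x with hφ'
  set ψ : ℝ → ℂ := fun x => if x ≤ -M then gm x else φ x with hψ
  set ψ' : ℝ → ℂ := fun x => if x ≤ -M then gm' x else φ' x with hψ'
  have m0 : f M = gp M := hep.symm
  have m1 : deriv f M = gp' M := by
    have : gp' M = α * gp M := by simp only [hgp, hgp']; ring
    rw [this, ← m0]
    linear_combination hp
  have hφd : ∀ x, HasDerivAt φ (φ' x) x :=
    hasDerivAt_ite_le hf.hasDerivAt (hasDerivAt_exp_mul cp α) m0 m1
  have n0 : gm (-M) = φ (-M) := by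
    simp only [hφ]
    rw [if_pos (by linarith)]
    exact hem
  have n1 : gm' (-M) = φ' (-M) := by
    have : gm' (-M) = -α * gm (-M) := by simp only [hgm, hgm']; ring
    rw [this, n0]
    simp only [hφ, hφ']
    rw [if_pos (by linarith), if_pos (by linarith)]
    linear_combination (-1) * hm
  have hψd : ∀ x, HasDerivAt ψ (ψ' x) x :=
    hasDerivAt_ite_le (hasDerivAt_exp_mul cm (-α)) hφd n0 n1
  have hdψ : deriv ψ = ψ' := funext fun x => (hψd x).deriv
  have hφ'c : Continuous φ' := continuous_ite_le hf.continuous_deriv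
    (by simp only [hgp']; fun_prop) m1
  have hψ'c : Continuous ψ' := continuous_ite_le (by simp only [hgm']; fun_prop) hφ'c n1
  have hinner : ∀ x, -M < x → x < M → ψ x = f x ∧ ψ' x = deriv f x := by
    intro x h1 h2
    simp only [hψ, hψ', hφ, hφ']
    rw [if_neg (not_le.2 h1), if_pos h2.le, if_neg (not_le.2 h1), if_pos h2.le]
    exact ⟨rfl, rfl⟩
  have houter : ∀ x, M < x → ψ x = gp x ∧ ψ' x = gp' x := by
    intro x h
    simp only [hψ, hψ', hφ, hφ']
    rw [if_neg (not_le.2 (by linarith)), if_neg (not_le.2 h), if_neg (not_le.2 (by linarith)),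
      if_neg (not_le.2 h)]
    exact ⟨rfl, rfl⟩
  refine ⟨ψ, ?_, ?_, ?_, ⟨cp, fun x hx => ?_⟩, ⟨cm, fun x hx => ?_⟩⟩
  · intro h
    have h0 := hinner 0 (by linarith) hM
    rw [← hdψ, h] at h0
    rcases hne with h1 | h1
    · exact h1 h0.1.symm
    · refine h1 (h0.2.symm.trans ?_)
      exact deriv_const _ _
  · exact contDiff_one_iff_deriv.2 ⟨fun x => (hψd x).differentiableAt, by rwa [hdψ]⟩
  · intro x hx
    rw [hdψ]
    rcases lt_or_ge x (-M) with h | h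
    · have hV : Vtrunc V M x = 0 :=
        if_neg (not_le.2 (lt_of_lt_of_le (by linarith) (neg_le_abs x)))
      rw [hV]
      have hψx : ψ x = gm x := if_pos h.le
      have hd : HasDerivAt gm' (((0 : ℝ) - z) * ψ x) x := by
        refine (hasDerivAt_exp_mul (cm * -α) (-α) x).congr_deriv ?_
        rw [hψx]
        simp only [hgm, Complex.ofReal_zero]
        linear_combination cm * Complex.exp (-α * x) * hα2
      refine hd.congr_of_eventuallyEq ?_
      filter_upwards [gt_mem_nhds h] with t ht using if_pos ht.le
    rcases lt_or_ge M x with h' | h'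
    · have hV : Vtrunc V M x = 0 := if_neg (not_le.2 (lt_of_lt_of_le h' (le_abs_self x)))
      rw [hV]
      have hd : HasDerivAt gp' (((0 : ℝ) - z) * ψ x) x := by
        refine (hasDerivAt_exp_mul (cp * α) α x).congr_deriv ?_
        rw [(houter x h').1]
        simp only [hgp, Complex.ofReal_zero]
        linear_combination cp * Complex.exp (α * x) * hα2
      refine hd.congr_of_eventuallyEq ?_
      filter_upwards [lt_mem_nhds h'] with t ht using (houter t ht).2
    have hlt : |x| < M := lt_of_le_of_ne (abs_le.2 ⟨h, h'⟩) hx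
    have h2 := abs_lt.1 hlt
    have hV : Vtrunc V M x = V x := if_pos hlt.le
    rw [hV, (hinner x h2.1 h2.2).1]
    refine (hf.2 x).congr_of_eventuallyEq ?_
    filter_upwards [lt_mem_nhds h2.1, gt_mem_nhds h2.2] with t h3 h4 using (hinner t h3 h4).2
  · rcases eq_or_lt_of_le hx with rfl | h
    · simp only [hψ, hφ]
      rw [if_neg (not_le.2 (by linarith)), if_pos le_rfl, hep]
    · exact (houter x h).1
  · rw [← neg_mul]
    exact if_pos hx

/-- The energy balance `Im z ∫ |f|² = -Re √z (|f(M)|² + |f(-M)|²)` has a sign. -/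
theorem im_neg_of_outgoing {V : ℝ → ℝ} (hV : Continuous V) {b : ℝ} (hb : ∀ x, |V x| ≤ b)
    {z : ℂ} {f : ℝ → ℂ} {M : ℝ} (hM : 0 < M) (hf : IsSchrodingerSolution V z f)
    (hne : f 0 ≠ 0 ∨ deriv f 0 ≠ 0) (hz : 0 < z.re) (hp : outPlus z f M = 0)
    (hm : outMinus z f M = 0) : z.im < 0 := by
  have hs : 0 < (csqrt z).re := lt_of_lt_of_le (Real.sqrt_pos.2 hz) (sqrt_le_csqrt_re le_rfl)
  have hcf := hf.continuous
  have hcd := hf.continuous_deriv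
  -- the real current `Im (conj f * f')`
  set J : ℝ → ℝ := fun x => (f x).re * (deriv f x).im - (f x).im * (deriv f x).re with hJ
  have hre : ∀ x, HasDerivAt (fun x => (f x).re) (deriv f x).re x := fun x =>
    Complex.reCLM.hasFDerivAt.comp_hasDerivAt x (hf.hasDerivAt x)
  have him : ∀ x, HasDerivAt (fun x => (f x).im) (deriv f x).im x := fun x =>
    Complex.imCLM.hasFDerivAt.comp_hasDerivAt x (hf.hasDerivAt x)
  have hre' : ∀ x, HasDerivAt (fun x => (deriv f x).re) (((V x : ℂ) - z) * f x).re x := fun x =>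
    Complex.reCLM.hasFDerivAt.comp_hasDerivAt x (hf.2 x)
  have him' : ∀ x, HasDerivAt (fun x => (deriv f x).im) (((V x : ℂ) - z) * f x).im x := fun x =>
    Complex.imCLM.hasFDerivAt.comp_hasDerivAt x (hf.2 x)
  have hJd : ∀ x, HasDerivAt J (-z.im * Complex.normSq (f x)) x := fun x =>
    (((hre x).mul (him' x)).sub ((him x).mul (hre' x))).congr_deriv (by
      simp only [Complex.mul_re, Complex.mul_im, Complex.sub_re, Complex.sub_im,
        Complex.ofReal_re, Complex.ofReal_im, Complex.normSq_apply]
      ring)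
  have hcn : Continuous fun x => Complex.normSq (f x) := Complex.continuous_normSq.comp hcf
  have hint := intervalIntegral.integral_eq_sub_of_hasDerivAt (a := -M) (b := M)
    (fun t _ => hJd t) (Continuous.intervalIntegrable (by fun_prop) _ _)
  rw [intervalIntegral.integral_const_mul] at hint
  have e1 : deriv f M = Complex.I * csqrt z * f M := by
    rw [outPlus] at hp; linear_combination hp
  have e2 : deriv f (-M) = -(Complex.I * csqrt z * f (-M)) := by
    rw [outMinus] at hm; linear_combination hm
  have j1 : J M = (csqrt z).re * Complex.normSq (f M) := by
    simp only [hJ, e1, Complex.normSq_apply]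
    simp
    ring
  have j2 : J (-M) = -((csqrt z).re * Complex.normSq (f (-M))) := by
    simp only [hJ, e2, Complex.normSq_apply]
    simp
    ring
  rw [j1, j2] at hint
  -- If f(M) = 0, the outgoing condition gives f'(M) = 0 too, and Wronskians with a basis make the
  -- data at 0 vanish.
  have hfM : 0 < Complex.normSq (f M) := by
    rw [Complex.normSq_pos]
    intro h0
    rw [h0, mul_zero] at e1
    obtain ⟨u, hu, hu0, hu1⟩ := exists_isSchrodingerSolution hV hb z 1 0
    obtain ⟨v, hv, hv0, hv1⟩ := exists_isSchrodingerSolution hV hb z 0 1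
    have h1 := hf.wronskian_eq hv M 0
    have h2 := hu.wronskian_eq hf M 0
    rw [h0, e1, hv0, hv1] at h1
    rw [h0, e1, hu0, hu1] at h2
    simp only [mul_one, mul_zero, sub_zero, zero_mul, one_mul] at h1 h2
    exact hne.elim (fun h => h h1) fun h => h h2
  have hnn : 0 ≤ Complex.normSq (f (-M)) := Complex.normSq_nonneg _
  have hint0 : 0 ≤ ∫ t in (-M)..M, Complex.normSq (f t) :=
    intervalIntegral.integral_nonneg (by linarith) fun t _ => Complex.normSq_nonneg _
  have hpos : 0 < (csqrt z).re * Complex.normSq (f M)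
      - -((csqrt z).re * Complex.normSq (f (-M))) := by
    have := mul_pos hs hfM
    have := mul_nonneg hs.le hnn
    linarith
  rw [← hint] at hpos
  by_contra hcon
  have := mul_nonneg (not_lt.1 hcon) hint0
  linarith

theorem isResonance_of_outgoing {V : ℝ → ℝ} (hV : Continuous V) {b : ℝ} (hb : ∀ x, |V x| ≤ b)
    {z : ℂ} {f : ℝ → ℂ} {M : ℝ} (hM : 0 < M) (hf : IsSchrodingerSolution V z f)
    (hne : f 0 ≠ 0 ∨ deriv f 0 ≠ 0) (hz : 0 < z.re) (hp : outPlus z f M = 0)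
    (hm : outMinus z f M = 0) : IsResonance V M z :=
  ⟨hz, im_neg_of_outgoing hV hb hM hf hne hz hp hm,
    exists_outgoing_extension hM hf hne hp hm⟩

/-! ### The solutions `u_ζ` and `v_η` as a dichotomy pair -/

/-- Reflection reverses the sign of the Wronskian; the extra minus sign on v restores the value 1.
-/
theorem IsSchrodingerSolution.neg_comp_neg {V : ℝ → ℝ} {z : ℂ} {f : ℝ → ℂ}
    (hf : IsSchrodingerSolution V z f) :
    IsSchrodingerSolution (fun x => V (-x)) z (fun x => -f (-x)) ∧
      deriv (fun x => -f (-x)) = fun x => deriv f (-x) := by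
  have h := hf.comp_neg.1.linearCombination hf.comp_neg.1 (-1) 0
  rw [hf.comp_neg.2] at h
  simpa using h

/-- The equation is real, so the conjugate solves it with the same data. -/
theorem IsSchrodingerSolution.im_eq_zero {V : ℝ → ℝ} {E : ℝ} {f : ℝ → ℂ} (hV : Continuous V)
    {b : ℝ} (hb : ∀ x, |V x| ≤ b) (hf : IsSchrodingerSolution V E f) (h0 : (f 0).im = 0)
    (h1 : (deriv f 0).im = 0) (x : ℝ) : (f x).im = 0 ∧ (deriv f x).im = 0 := by
  have h := hf.conj.1.eq_of_initial hV hb hf (Complex.conj_eq_iff_im.2 h0)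
    (by rw [hf.conj.2]; exact Complex.conj_eq_iff_im.2 h1)
  have hd := hf.conj.2
  rw [h] at hd
  exact ⟨Complex.conj_eq_iff_im.1 (congrFun h x), Complex.conj_eq_iff_im.1 (congrFun hd x).symm⟩

/-- The Cauchy data of a decaying solution are proportional to real ones. -/
theorem IsSchrodingerSolution.wronskian_conj_eq_zero {V : ℝ → ℝ} {E κ C : ℝ} {f : ℝ → ℂ}
    (hf : IsSchrodingerSolution V E f) (hκ : 0 < κ)
    (h0 : ∀ x, 0 ≤ x → ‖f x‖ ≤ C * Real.exp (-κ * x))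
    (h1 : ∀ x, 0 ≤ x → ‖deriv f x‖ ≤ C * Real.exp (-κ * x)) :
    f 0 * (starRingEnd ℂ) (deriv f 0) - deriv f 0 * (starRingEnd ℂ) (f 0) = 0 := by
  have hlim : Filter.Tendsto (fun x : ℝ => C * Real.exp (-κ * x)) Filter.atTop (nhds 0) := by
    have : Filter.Tendsto (fun x : ℝ => -κ * x) Filter.atTop Filter.atBot :=
      Filter.tendsto_id.const_mul_atTop_of_neg (by linarith)
    simpa using (Real.tendsto_exp_atBot.comp this).const_mul C
  have t0 : Filter.Tendsto f Filter.atTop (nhds 0) := squeeze_zero_norm'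
    (by filter_upwards [Filter.eventually_ge_atTop 0] with x hx using h0 x hx) hlim
  have t1 : Filter.Tendsto (deriv f) Filter.atTop (nhds 0) := squeeze_zero_norm'
    (by filter_upwards [Filter.eventually_ge_atTop 0] with x hx using h1 x hx) hlim
  -- The Wronskian of f with its conjugate is constant and tends to zero at infinity.
  have tw := (t0.mul (t1.star)).sub (t1.mul (t0.star))
  simp only [star_zero, mul_zero, sub_zero] at tw
  refine tendsto_nhds_unique (tendsto_const_nhds.congr fun x => ?_) tw
  have := hf.wronskian_eq hf.conj.1 0 x
  rw [hf.conj.2] at this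
  exact this.symm

/-- Collects all that the Newton argument needs about Φ and v_η: the same B serves both half-lines,
and reality of Φ and v_η supplies the lower bounds. -/
theorem exists_dichotomyPair {V Vper : ℝ → ℝ} {ρ E : ℝ} {Φ : ℝ → ℂ} (hρ : 0 ≤ ρ)
    (hV : Continuous V) (hVW : ∀ x, ρ < |x| → V x = Vper x) (hper : ∀ x, Vper (x + 1) = Vper x)
    (hΦ : IsBoundState V E Φ) (hnorm : Φ 0 = 1 ∨ (Φ 0 = 0 ∧ deriv Φ 0 = 1)) {b : ℝ}
    (hb : ∀ x, |V x| ≤ b) :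
    ∃ κ, IsFloquetExponent Vper E κ ∧ uSol V Φ (etaVec Φ E) = Φ ∧ ∃ (B : ℝ) (a : ℂ),
      IsDichotomyPair V E κ B Φ (vSol V Φ (etaVec Φ E)) ∧
      IsDichotomyPair (fun x => V (-x)) E κ B (fun x => Φ (-x))
        (fun x => -vSol V Φ (etaVec Φ E) (-x)) ∧
      (∀ x, (Φ x).im = 0) ∧
      (∀ x, (vSol V Φ (etaVec Φ E) x).im = 0 ∧ (deriv (vSol V Φ (etaVec Φ E)) x).im = 0) ∧
      ∀ ζ : ℂ × ℂ, IsSchrodingerSolution V ζ.2 (uSol V Φ ζ) ∧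
        HasCombinedData Φ (vSol V Φ (etaVec Φ E)) a (ζ.1 - wZero Φ) (uSol V Φ ζ) ∧
        (uSol V Φ ζ 0 ≠ 0 ∨ deriv (uSol V Φ ζ) 0 ≠ 0) := by
  obtain ⟨κ, hFl, ⟨C₁, hdec⟩, hgrow⟩ := hΦ.exists_floquetExponent hρ hV hVW hper
  have hsol := hΦ.2.2
  have hκ := hFl.1
  -- When Φ(0) = 1 this says that Φ'(0) is real, which is not assumed; in particular 1 + w₀² ≠ 0.
  have hWc := hsol.wronskian_conj_eq_zero hκ (fun x hx => (hdec x hx).1.1)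
    fun x hx => (hdec x hx).1.2
  set v := vSol V Φ (etaVec Φ E) with hvdef
  obtain ⟨a, hv, hW, hv0, hv1, hΦ0, hΦ1, hu, hη⟩ : ∃ a : ℂ, IsSchrodingerSolution V E v ∧
      Φ 0 * deriv v 0 - deriv Φ 0 * v 0 = 1 ∧ (v 0).im = 0 ∧ (deriv v 0).im = 0 ∧
      (Φ 0).im = 0 ∧ (deriv Φ 0).im = 0 ∧
      (∀ ζ : ℂ × ℂ, IsSchrodingerSolution V ζ.2 (uSol V Φ ζ) ∧
        HasCombinedData Φ v a (ζ.1 - wZero Φ) (uSol V Φ ζ) ∧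
        (uSol V Φ ζ 0 ≠ 0 ∨ deriv (uSol V Φ ζ) 0 ≠ 0)) ∧ uSol V Φ (etaVec Φ E) = Φ := by
    rcases hnorm with h0 | ⟨h0, h1⟩
    · have hne : Φ 0 ≠ 0 := by rw [h0]; exact one_ne_zero
      have hw : wZero Φ = deriv Φ 0 := if_pos hne
      rw [h0, map_one, one_mul, mul_one, sub_eq_zero] at hWc
      have him := Complex.conj_eq_iff_im.1 hWc
      obtain ⟨w, hwr⟩ : ∃ w : ℝ, deriv Φ 0 = w := ⟨_, (Complex.conj_eq_iff_re.1 hWc).symm⟩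
      have hw1 : (1 + (w : ℂ) ^ 2) ≠ 0 := by
        have : (1 + w ^ 2 : ℝ) ≠ 0 := by positivity
        exact_mod_cast this
      have hvs := ivpSolution_spec hV hb E (-(w : ℂ) / (1 + (w : ℂ) ^ 2)) (1 / (1 + (w : ℂ) ^ 2))
      have hve : v = ivpSolution V E (-(w : ℂ) / (1 + (w : ℂ) ^ 2)) (1 / (1 + (w : ℂ) ^ 2)) := by
        rw [hvdef, vSol, if_pos hne]
        simp only [etaVec, hw, hwr]
      rw [← hve] at hvs
      have hus : ∀ ζ : ℂ × ℂ, uSol V Φ ζ = ivpSolution V ζ.2 1 ζ.1 := fun ζ => if_pos hne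
      -- The vector (0, δ) is resolved along (1, w₀) and the orthogonal data of v_η; its first
      -- coefficient is δ w₀/(1 + w₀²). In the case Φ(0) = 0 the variation lies along v_η alone,
      -- whence a = 0.
      refine ⟨w / (1 + (w : ℂ) ^ 2), hvs.1, ?_, ?_, ?_, by rw [h0]; simp, him, fun ζ => ?_, ?_⟩
      · rw [hvs.2.1, hvs.2.2, h0, hwr]
        field_simp
        ring
      · rw [hvs.2.1]
        exact_mod_cast Complex.ofReal_im (-w / (1 + w ^ 2))
      · rw [hvs.2.2]
        exact_mod_cast Complex.ofReal_im (1 / (1 + w ^ 2))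
      · obtain ⟨s1, s2, s3⟩ := ivpSolution_spec hV hb ζ.2 1 ζ.1
        rw [hus]
        refine ⟨s1, ⟨?_, ?_⟩, Or.inl (by rw [s2]; exact one_ne_zero)⟩
        · rw [s2, hvs.2.1, h0, hw, hwr]
          field_simp
          ring
        · rw [s3, hvs.2.2, hw, hwr]
          field_simp
          ring
      · obtain ⟨s1, s2, s3⟩ := ivpSolution_spec hV hb E 1 (deriv Φ 0)
        rw [hus]
        simp only [etaVec, hw]
        exact s1.eq_of_initial hV hb hsol (s2.trans h0.symm) s3
    · have hne : ¬ Φ 0 ≠ 0 := by simp [h0]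
      have hw : wZero Φ = 0 := if_neg hne
      have hvs := ivpSolution_spec hV hb E (-1) 0
      have hve : v = ivpSolution V E (-1) 0 := by
        rw [hvdef, vSol, if_neg hne]
        simp [etaVec, hw]
      rw [← hve] at hvs
      have hus : ∀ ζ : ℂ × ℂ, uSol V Φ ζ = ivpSolution V ζ.2 (-ζ.1) 1 := fun ζ => if_neg hne
      refine ⟨0, hvs.1, ?_, ?_, ?_, by rw [h0]; simp, by rw [h1]; simp, fun ζ => ?_, ?_⟩
      · rw [hvs.2.1, hvs.2.2, h0, h1]; ring
      · rw [hvs.2.1]; simp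
      · rw [hvs.2.2]; simp
      · obtain ⟨s1, s2, s3⟩ := ivpSolution_spec hV hb ζ.2 (-ζ.1) 1
        rw [hus]
        refine ⟨s1, ⟨?_, ?_⟩, Or.inr (by rw [s3]; exact one_ne_zero)⟩
        · rw [s2, hvs.2.1, h0, hw]; ring
        · rw [s3, hvs.2.2, h1]; ring
      · obtain ⟨s1, s2, s3⟩ := ivpSolution_spec hV hb E 0 1
        rw [hus]
        simp only [etaVec, hw, neg_zero]
        exact s1.eq_of_initial hV hb hsol (s2.trans h0.symm) (s3.trans h1.symm)
  obtain ⟨C₂, hgr⟩ := hgrow v hv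
  have hmono₁ : ∀ {y x : ℝ}, y ≤ C₁ * Real.exp (-κ * x) → y ≤ max C₁ C₂ * Real.exp (-κ * x) :=
    fun h => h.trans (mul_le_mul_of_nonneg_right (le_max_left _ _) (Real.exp_pos _).le)
  have hmono₂ : ∀ {y x : ℝ}, y ≤ C₂ * Real.exp (κ * x) → y ≤ max C₁ C₂ * Real.exp (κ * x) :=
    fun h => h.trans (mul_le_mul_of_nonneg_right (le_max_right _ _) (Real.exp_pos _).le)
  refine ⟨κ, hFl, hη, max C₁ C₂, a, ?_, ?_, fun x => (hsol.im_eq_zero hV hb hΦ0 hΦ1 x).1,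
    hv.im_eq_zero hV hb hv0 hv1, hu⟩
  · exact ⟨hκ, hsol, hv, hW, fun x hx => hmono₁ (hdec x hx).1.1,
      fun x hx => hmono₁ (hdec x hx).1.2, fun x hx => hmono₂ (hgr x hx).1.1,
      fun x hx => hmono₂ (hgr x hx).1.2⟩
  · refine ⟨hκ, hsol.comp_neg.1, hv.neg_comp_neg.1, ?_, fun x hx => hmono₁ (hdec x hx).2.1,
      fun x hx => ?_, fun x hx => ?_, fun x hx => ?_⟩
    · rw [hsol.comp_neg.2, hv.neg_comp_neg.2]
      simp only [neg_zero]
      linear_combination hW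
    · rw [hsol.comp_neg.2, norm_neg]
      exact hmono₁ (hdec x hx).2.2
    · rw [norm_neg]
      exact hmono₂ (hgr x hx).2.1
    · rw [hv.neg_comp_neg.2]
      exact hmono₂ (hgr x hx).2.2

/-! ### Two-sided estimates -/

theorem outPlus_comp_neg {V : ℝ → ℝ} {z z' : ℂ} {f : ℝ → ℂ} (hf : IsSchrodingerSolution V z f)
    (M : ℝ) : outPlus z' (fun x => f (-x)) M = -outMinus z' f M := by
  rw [outPlus, outMinus, hf.comp_neg.2]
  ring

theorem outPlus_neg_comp_neg {V : ℝ → ℝ} {z z' : ℂ} {f : ℝ → ℂ}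
    (hf : IsSchrodingerSolution V z f) (M : ℝ) :
    outPlus z' (fun x => -f (-x)) M = outMinus z' f M := by
  rw [outPlus, outMinus, hf.neg_comp_neg.2]
  ring

theorem HasCombinedData.comp_neg {V : ℝ → ℝ} {z z' : ℂ} {u v f : ℝ → ℂ} {a δ : ℂ}
    (hu : IsSchrodingerSolution V z u) (hv : IsSchrodingerSolution V z v)
    (hf : IsSchrodingerSolution V z' f) (h : HasCombinedData u v a δ f) :
    HasCombinedData (fun x => u (-x)) (fun x => -v (-x)) (-a) (-δ) (fun x => f (-x)) := by
  rw [HasCombinedData, hu.comp_neg.2, hv.neg_comp_neg.2, hf.comp_neg.2]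
  simp only [neg_zero]
  rw [h.1, h.2]
  constructor <;> ring

/-- This is the kernel bound with P = e^{κM} and Q = 0, after cancelling e^{κM}. -/
theorem IsDichotomyPair.norm_integral_sq_le {V : ℝ → ℝ} {E κ B : ℝ} {u v : ℝ → ℂ}
    (h : IsDichotomyPair V E κ B u v) {M : ℝ} (hM : 0 ≤ M) :
    ‖∫ t in (0 : ℝ)..M, u t ^ 2‖ ≤ B ^ 2 / κ := by
  have hκ := h.pos
  have he := Real.exp_pos (κ * M)
  have := h.norm_kernel_integral_le (P := (Real.exp (κ * M) : ℂ)) (Q := 0) (b := 1) hM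
    (by rw [Complex.norm_real, Real.norm_eq_abs, Real.abs_exp, one_mul])
    (by rw [norm_zero]; positivity) (g := u) (G₁ := B) (G₂ := 0) h.bound_nonneg
    (fun t ht => by simpa using h.u_le t ht.1)
  have e : ∫ t in (0 : ℝ)..M, ((Real.exp (κ * M) : ℂ) * u t - 0 * v t) * u t
      = (Real.exp (κ * M) : ℂ) * ∫ t in (0 : ℝ)..M, u t ^ 2 := by
    rw [← intervalIntegral.integral_const_mul]
    exact intervalIntegral.integral_congr fun t _ => by ring
  rw [e, norm_mul, Complex.norm_real, Real.norm_eq_abs, Real.abs_exp] at this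
  refine le_of_mul_le_mul_left (this.trans (le_of_eq ?_)) he
  field_simp
  ring

/-- For real f the square cannot cancel, so the integral increases with the interval and the one
over [-1, 1] serves as c. -/
theorem exists_le_norm_integral_sq {f : ℝ → ℂ} (hf : Continuous f) (him : ∀ x, (f x).im = 0)
    (hne : f 0 ≠ 0 ∨ deriv f 0 ≠ 0) :
    ∃ c, 0 < c ∧ ∀ M, 1 ≤ M → c ≤ ‖∫ t in (-M)..M, f t ^ 2‖ := by
  have hre : ∀ t, f t ^ 2 = (((f t).re ^ 2 : ℝ) : ℂ) := fun t => by
    rw [Complex.ofReal_pow]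
    congr 1
    exact Complex.ext (by simp) (by simpa using him t)
  have hc : Continuous fun t => (f t).re ^ 2 := by
    have := Complex.continuous_re.comp hf
    exact this.pow 2
  have hint : ∀ a b, IntervalIntegrable (fun t => (f t).re ^ 2) volume a b := fun a b =>
    hc.intervalIntegrable a b
  refine ⟨∫ t in (-1 : ℝ)..1, (f t).re ^ 2, ?_, fun M hM => ?_⟩
  · refine intervalIntegral.integral_pos (by norm_num) hc.continuousOn
      (fun t _ => by positivity) ?_
    by_contra hcon
    push Not at hcon
    have hz : ∀ t ∈ Set.Icc (-1 : ℝ) 1, f t = 0 := fun t ht => by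
      have h1 := hcon t ht
      have h2 : (f t).re ^ 2 = 0 := le_antisymm h1 (by positivity)
      exact Complex.ext (by simpa using h2) (him t)
    have he : f =ᶠ[nhds 0] fun _ => 0 := by
      filter_upwards [Icc_mem_nhds (show (-1 : ℝ) < 0 by norm_num) one_pos] with t ht using hz t ht
    rcases hne with h | h
    · exact h he.self_of_nhds
    · exact h (by rw [he.deriv_eq, deriv_const])
  · have e : ∫ t in (-M)..M, f t ^ 2 = ((∫ t in (-M)..M, (f t).re ^ 2 : ℝ) : ℂ) := by
      rw [← intervalIntegral.integral_ofReal]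
      exact intervalIntegral.integral_congr fun t _ => hre t
    rw [e, Complex.norm_real, Real.norm_eq_abs]
    refine le_trans ?_ (le_abs_self _)
    exact intervalIntegral.integral_mono_interval (by linarith) (by norm_num) hM
      (Filter.Eventually.of_forall fun t => by positivity) (hint _ _)

/-! ### Large-M thresholds and the ball Ω_M -/

theorem exists_thresholds {κ : ℝ} (hκ : 0 < κ) (ρ : ℝ) {ε D D' : ℝ} (hε : 0 < ε) :
    ∃ M₀, ρ < M₀ ∧ 1 ≤ M₀ ∧ ∀ M, M₀ ≤ M → 1 / M ≤ ε ∧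
      D * (M ^ 2 * Real.exp (-κ * M) + 1 / M) ≤ 1 / 4 ∧
      D' * (M ^ 2 * Real.exp (-κ * M)) ≤ 1 / 4 := by
  have hX : Filter.Tendsto (fun M : ℝ => M ^ 2 * Real.exp (-κ * M)) Filter.atTop (nhds 0) := by
    simpa using tendsto_rpow_mul_exp_neg_mul_atTop_nhds_zero 2 κ hκ
  have hY : Filter.Tendsto (fun M : ℝ => 1 / M) Filter.atTop (nhds 0) := by
    simpa using tendsto_inv_atTop_zero (𝕜 := ℝ)
  have h1 := hY.eventually_le_const hε
  have h2 : ∀ᶠ M : ℝ in Filter.atTop, D * (M ^ 2 * Real.exp (-κ * M) + 1 / M) ≤ 1 / 4 :=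
    Filter.Tendsto.eventually_le_const (by norm_num : (0 : ℝ) < 1 / 4)
      (by simpa using (hX.add hY).const_mul D)
  have h3 : ∀ᶠ M : ℝ in Filter.atTop, D' * (M ^ 2 * Real.exp (-κ * M)) ≤ 1 / 4 :=
    Filter.Tendsto.eventually_le_const (by norm_num : (0 : ℝ) < 1 / 4)
      (by simpa using hX.const_mul D')
  obtain ⟨N, hN⟩ := Filter.eventually_atTop.1 (h1.and (h2.and h3))
  exact ⟨max (max N (ρ + 1)) 1,
    lt_of_lt_of_le (by linarith) ((le_max_right N (ρ + 1)).trans (le_max_left _ _)),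
    le_max_right _ _, fun M hM => hN M (((le_max_left _ _).trans (le_max_left _ _)).trans hM)⟩

theorem isClosed_omegaBall (Φ : ℝ → ℂ) (E k M : ℝ) : IsClosed (OmegaBall Φ E k M) :=
  isClosed_le (by fun_prop) continuous_const

/-- The Euclidean norm on ℂ² is at most √2 times the sup norm, and √2 < 2. -/
theorem mem_omegaBall_of_norm_le {Φ : ℝ → ℂ} {E k M : ℝ} {ζ : ℂ × ℂ}
    (h : ‖ζ - etaVec Φ E‖ ≤ 1 / M ^ 2 * Real.exp (-(k * M)) / 2) : ζ ∈ OmegaBall Φ E k M := by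
  have h1 : ‖ζ.1 - (etaVec Φ E).1‖ ≤ _ := (norm_fst_le (ζ - etaVec Φ E)).trans h
  have h2 : ‖ζ.2 - (etaVec Φ E).2‖ ≤ _ := (norm_snd_le (ζ - etaVec Φ E)).trans h
  have h0 : 0 ≤ 1 / M ^ 2 * Real.exp (-(k * M)) := by positivity
  refine Real.sqrt_le_iff.2 ⟨h0, ?_⟩
  nlinarith [pow_le_pow_left₀ (norm_nonneg _) h1 2, pow_le_pow_left₀ (norm_nonneg _) h2 2]

theorem norm_le_of_mem_omegaBall {Φ : ℝ → ℂ} {E k M : ℝ} {ζ : ℂ × ℂ}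
    (h : ζ ∈ OmegaBall Φ E k M) :
    ‖ζ - etaVec Φ E‖ ≤ 1 / M ^ 2 * Real.exp (-(k * M)) :=
  max_le ((Real.le_sqrt_of_sq_le (by simp)).trans h)
    ((Real.le_sqrt_of_sq_le (by simp)).trans h)

/-- The spare rate κ - k absorbs the factor M through t + 1 ≤ e^t. -/
theorem mul_exp_le_mul_exp {κ k M : ℝ} (hk : k < κ) :
    M * Real.exp (-(4 * κ * M)) ≤ 1 / (4 * (κ - k)) * Real.exp (-(4 * k * M)) := by
  have hd : 0 < 4 * (κ - k) := by linarith
  have h1 : M ≤ 1 / (4 * (κ - k)) * Real.exp (4 * (κ - k) * M) := by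
    rw [one_div, le_inv_mul_iff₀ hd]
    linarith [Real.add_one_le_exp (4 * (κ - k) * M)]
  calc _ ≤ 1 / (4 * (κ - k)) * Real.exp (4 * (κ - k) * M) * Real.exp (-(4 * κ * M)) := by gcongr
    _ = _ := by rw [mul_assoc, ← Real.exp_add]; ring_nf

/-- `Θ` divided by the growing factors is affine up to a small Lipschitz error. -/
theorem exists_theta_lipschitz {V : ℝ → ℝ} {Φ v : ℝ → ℂ} {E κ B : ℝ} {a : ℂ} (hE : 0 < E)
    (h : IsDichotomyPair V E κ B Φ v)
    (h' : IsDichotomyPair (fun x => V (-x)) E κ B (fun x => Φ (-x)) (fun x => -v (-x)))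
    (hv : ∀ x, (v x).im = 0 ∧ (deriv v x).im = 0)
    (hu : ∀ ζ : ℂ × ℂ, IsSchrodingerSolution V ζ.2 (uSol V Φ ζ) ∧
        HasCombinedData Φ v a (ζ.1 - wZero Φ) (uSol V Φ ζ)) :
    ∃ C, 0 < C ∧ ∃ ε, 0 < ε ∧ ∀ M r : ℝ, 1 ≤ M → 0 ≤ r → M * r ≤ ε →
      ∀ x y : ℂ × ℂ, ‖x - etaVec Φ E‖ ≤ r → ‖y - etaVec Φ E‖ ≤ r →
        ‖(Theta V Φ M x).1 - (Theta V Φ M y).1 - outPlus E v M * ((x.1 - y.1)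
            - (x.2 - y.2) * ∫ t in (0 : ℝ)..M, Φ t ^ 2)‖
          ≤ C * (M * (Real.exp (-κ * M) ^ 2 + r)) * ‖x - y‖ * ‖outPlus E v M‖ ∧
        ‖(Theta V Φ M x).2 - (Theta V Φ M y).2 - outMinus E v M * ((x.1 - y.1)
            + (x.2 - y.2) * ∫ t in (-M)..0, Φ t ^ 2)‖
          ≤ C * (M * (Real.exp (-κ * M) ^ 2 + r)) * ‖x - y‖ * ‖outMinus E v M‖ := by
  obtain ⟨C₁, hC₁, ε₁, hε₁, H₁⟩ := h.exists_outPlus_lipschitz hE a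
  obtain ⟨C₂, hC₂, ε₂, hε₂, H₂⟩ := h'.exists_outPlus_lipschitz hE (-a)
  have hB := h.bound_nonneg
  set c := B * (1 + 1 / Real.sqrt E) with hc
  have hc0 : 0 ≤ c := by positivity
  refine ⟨2 * (C₁ + C₂) * (c + 1), by positivity, min ε₁ ε₂, lt_min hε₁ hε₂, ?_⟩
  intro M r hM hr hMr x y hx hy
  have hM0 : 0 ≤ M := by linarith
  have hx1 : ‖x.1 - wZero Φ‖ ≤ r := (norm_fst_le (x - etaVec Φ E)).trans hx
  have hx2 : ‖x.2 - (E : ℂ)‖ ≤ r := (norm_snd_le (x - etaVec Φ E)).trans hx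
  have hy1 : ‖y.1 - wZero Φ‖ ≤ r := (norm_fst_le (y - etaVec Φ E)).trans hy
  have hy2 : ‖y.2 - (E : ℂ)‖ ≤ r := (norm_snd_le (y - etaVec Φ E)).trans hy
  obtain ⟨sx, dx⟩ := hu x
  obtain ⟨sy, dy⟩ := hu y
  have hp := H₁ M r hM hr (hMr.trans (min_le_left _ _)) x.2 y.2 _ _ _ _ hx2 hy2 hy1 sx dx sy dy
  have hm := H₂ M r hM hr (hMr.trans (min_le_right _ _)) x.2 y.2 _ _ _ _ hx2 hy2
    (by rwa [norm_neg]) sx.comp_neg.1 (dx.comp_neg h.sol_u h.sol_v sx) sy.comp_neg.1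
    (dy.comp_neg h.sol_u h.sol_v sy)
  have hAp := h.exp_le_norm_outPlus_v hE hM0 (hv M).1 (hv M).2
  have hAm := h'.exp_le_norm_outPlus_v hE hM0 (by simpa using (hv (-M)).1)
    (by rw [h.sol_v.neg_comp_neg.2]; exact (hv (-M)).2)
  have hI : ∫ t in (0 : ℝ)..M, Φ (-t) ^ 2 = ∫ t in (-M)..0, Φ t ^ 2 := by
    rw [intervalIntegral.integral_comp_neg fun t => Φ t ^ 2, neg_zero]
  rw [outPlus_neg_comp_neg h.sol_v] at hAm hm
  rw [outPlus_comp_neg sx, outPlus_comp_neg sy, hI] at hm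
  have e1 : ∀ δ₁ δ₂ : ℂ, δ₁ - wZero Φ - (δ₂ - wZero Φ) = δ₁ - δ₂ := fun _ _ => by ring
  rw [e1] at hp
  rw [← norm_neg, show -(x.1 - wZero Φ) - -(y.1 - wZero Φ) = -(x.1 - y.1) by ring,
    norm_neg (x.1 - y.1)] at hm
  -- The lower bound on |A| turns e^{-κM} + r e^{κM} = (e^{-2κM} + r)e^{κM} into a multiple of
  -- (e^{-2κM} + r)|A|.
  have hfin : ∀ (C' : ℝ) (A : ℂ), 0 < C' → C' ≤ C₁ + C₂ → Real.exp (κ * M) ≤ c * ‖A‖ →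
      C' * (M * (Real.exp (-κ * M) + r * Real.exp (κ * M))) * (‖x.1 - y.1‖ + ‖x.2 - y.2‖)
        ≤ 2 * (C₁ + C₂) * (c + 1) * (M * (Real.exp (-κ * M) ^ 2 + r)) * ‖x - y‖ * ‖A‖ := by
    intro C' A hC' hle hA
    have n1 : ‖x.1 - y.1‖ ≤ ‖x - y‖ := norm_fst_le (x - y)
    have n2 : ‖x.2 - y.2‖ ≤ ‖x - y‖ := norm_snd_le (x - y)
    have ee : Real.exp (-κ * M) + r * Real.exp (κ * M)
        = (Real.exp (-κ * M) ^ 2 + r) * Real.exp (κ * M) := by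
      have : Real.exp (-κ * M) * Real.exp (κ * M) = 1 := by
        rw [← Real.exp_add, show -κ * M + κ * M = 0 by ring, Real.exp_zero]
      linear_combination (-Real.exp (-κ * M)) * this
    have hA' : Real.exp (κ * M) ≤ (c + 1) * ‖A‖ := by linarith [norm_nonneg A]
    rw [ee]
    calc _ ≤ (C₁ + C₂) * (M * ((Real.exp (-κ * M) ^ 2 + r) * ((c + 1) * ‖A‖)))
          * (‖x - y‖ + ‖x - y‖) := by gcongr
      _ = _ := by ring
  constructor
  · refine le_trans ?_ (hp.trans (hfin C₁ _ hC₁ (by linarith) hAp))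
    exact le_rfl
  · refine le_trans (le_of_eq (congrArg norm ?_)) (hm.trans (hfin C₂ _ hC₂ (by linarith) hAm))
    simp only [Theta]
    ring

/-- Solving the 2 × 2 linear model with right-hand side (B₊/A₊, B₋/A₋) and clearing denominators
gives the stated formulas exactly; no error enters here. -/
theorem approx_eq {V : ℝ → ℝ} {Φ : ℝ → ℂ} {E M : ℝ} (hη : uSol V Φ (etaVec Φ E) = Φ)
    (hAp : outPlus E (vSol V Φ (etaVec Φ E)) M ≠ 0)
    (hAm : outMinus E (vSol V Φ (etaVec Φ E)) M ≠ 0)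
    (hsplit : uSqInt V Φ E (-M) M = (∫ t in (-M)..0, Φ t ^ 2) + ∫ t in (0 : ℝ)..M, Φ t ^ 2)
    (hI : (∫ t in (-M)..0, Φ t ^ 2) + ∫ t in (0 : ℝ)..M, Φ t ^ 2 ≠ 0) :
    (wApprox V Φ E M, zApprox V Φ E M) = etaVec Φ E - linearizedInverse
      (∫ t in (0 : ℝ)..M, Φ t ^ 2) (∫ t in (-M)..0, Φ t ^ 2)
      ((Theta V Φ M (etaVec Φ E)).1 / outPlus E (vSol V Φ (etaVec Φ E)) M,
        (Theta V Φ M (etaVec Φ E)).2 / outMinus E (vSol V Φ (etaVec Φ E)) M) := by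
  have hΘ : Theta V Φ M (etaVec Φ E) = (outPlus E Φ M, outMinus E Φ M) := by
    rw [Theta, hη]
    rfl
  have h1 : uSqInt V Φ E (-M) 0 = ∫ t in (-M)..0, Φ t ^ 2 := by rw [uSqInt, hη]
  have h2 : uSqInt V Φ E 0 M = ∫ t in (0 : ℝ)..M, Φ t ^ 2 := by rw [uSqInt, hη]
  rw [hΘ, wApprox, zApprox, corrDenom, hsplit, hη, h1, h2]
  generalize outPlus E (vSol V Φ (etaVec Φ E)) M = Ap at *
  generalize outMinus E (vSol V Φ (etaVec Φ E)) M = Am at *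
  refine Prod.ext ?_ ?_
  · change wZero Φ - _ = wZero Φ - _
    congr 1
    simp only [linearizedInverse]
    field_simp
  · change (E : ℂ) - _ = (E : ℂ) - _
    congr 1
    simp only [linearizedInverse]
    field_simp

/-! ### Assembly: the root, its resonance property and the remainders -/

set_option maxHeartbeats 2000000 in
theorem mainTheorem5
    (V Vper Vdef : ℝ → ℝ) (ρ : ℝ) (hρ : 0 ≤ ρ)
    (hV_smooth : ContDiff ℝ ∞ V)
    (hV_sum : ∀ x : ℝ, V x = Vper x + Vdef x)
    (hV_per : ∀ x : ℝ, Vper (x + 1) = Vper x)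
    (hV_def : ∀ x : ℝ, ρ < |x| → Vdef x = 0)
    (E : ℝ) (hE : 0 < E)
    (Φ : ℝ → ℂ) (hΦ : IsBoundState V E Φ)
    (hΦ_norm : Φ 0 = 1 ∨ (Φ 0 = 0 ∧ deriv Φ 0 = 1)) :
    ∃ κ : ℝ, IsFloquetExponent Vper E κ ∧
      ∀ k : ℝ, 0 < k → k ≤ κ →
        ∃ M₀ : ℝ, ρ < M₀ ∧ ∃ C : ℝ, 0 < C ∧ ∀ M : ℝ, M₀ ≤ M →
          corrDenom V Φ E M ≠ 0 ∧
          ∃ wstar zstar : ℂ,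
            (wstar, zstar) ∈ OmegaBall Φ E k M ∧
            Theta V Φ M (wstar, zstar) = 0 ∧
            (∀ ζ ∈ OmegaBall Φ E k M, Theta V Φ M ζ = 0 → ζ = (wstar, zstar)) ∧
            IsResonance V M zstar ∧
            ‖wstar - wApprox V Φ E M‖ ≤ C * (M * Real.exp (-(4 * κ * M))) ∧
            ‖zstar - zApprox V Φ E M‖ ≤ C * (M * Real.exp (-(4 * κ * M))) ∧
            (k < κ →
              ‖wstar - wApprox V Φ E M‖ ≤ C * Real.exp (-(4 * k * M)) ∧
              ‖zstar - zApprox V Φ E M‖ ≤ C * Real.exp (-(4 * k * M))) := by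
  have hV : Continuous V := hV_smooth.continuous
  have hVW : ∀ x, ρ < |x| → V x = Vper x := fun x hx => by rw [hV_sum, hV_def x hx, add_zero]
  obtain ⟨b₀, hb₀⟩ := exists_bound_periodic (continuous_periodic_part hV hVW hV_per) hV_per
  obtain ⟨b, hb⟩ := exists_bound_of_eq_periodic hV hVW hb₀
  obtain ⟨κ, hFl, hη, B, a, hpair, hpair', hΦre, hvre, hu⟩ :=
    exists_dichotomyPair hρ hV hVW hV_per hΦ hΦ_norm hb
  refine ⟨κ, hFl, fun k hk hkκ => ?_⟩
  set v := vSol V Φ (etaVec Φ E) with hvdef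
  have hκ := hpair.pos
  have hB := hpair.bound_nonneg
  obtain ⟨C, hC, ε, hε, hlip⟩ :=
    exists_theta_lipschitz hE hpair hpair' hvre fun ζ => ⟨(hu ζ).1, (hu ζ).2.1⟩
  obtain ⟨c, hc, hcI⟩ := exists_le_norm_integral_sq hpair.sol_u.continuous hΦre
    (by rcases hΦ_norm with h | h <;> simp [h])
  set cA := B * (1 + 1 / Real.sqrt E) with hcA
  have hcA0 : 0 ≤ cA := by positivity
  set γ₀ := (1 + Real.sqrt E) * B * cA with hγ₀
  have hγ₀0 : 0 ≤ γ₀ := by positivity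
  set K := 2 * (B ^ 2 / κ + 1) / c with hK
  have hK0 : 0 ≤ K := by positivity
  obtain ⟨M₀, hρM₀, hM₀1, hM₀⟩ := exists_thresholds hκ ρ (ε := min ε (E / 2)) (D := K * C)
    (D' := K * γ₀) (lt_min hε (by linarith))
  set C' := K * (C * (1 + 2 * (K * γ₀)) * (2 * (K * γ₀))) with hC'
  have hC'0 : 0 ≤ C' := by positivity
  -- For k = κ the quotient is 1/0 = 0, so one constant covers both cases; the absolute value keeps
  -- it nonnegative without knowing k < κ.
  have hCk0 : 0 ≤ C' * |1 / (4 * (κ - k))| := by positivity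
  refine ⟨M₀, hρM₀, C' + C' * |1 / (4 * (κ - k))| + 1, by linarith, fun M hM => ?_⟩
  have hM1 : 1 ≤ M := hM₀1.trans hM
  have hM0 : 0 ≤ M := by linarith
  have hMpos : 0 < M := by linarith
  obtain ⟨hT1, hT2, hT3⟩ := hM₀ M hM
  set r := 1 / M ^ 2 * Real.exp (-(k * M)) with hr
  have hr0 : 0 ≤ r := by positivity
  have hrk : Real.exp (-(k * M)) ≤ 1 := Real.exp_le_one_iff.2 (by nlinarith)
  have hMr : M * r ≤ 1 / M := by
    have : M * r = 1 / M * Real.exp (-(k * M)) := by rw [hr]; field_simp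
    rw [this]
    exact mul_le_of_le_one_right (by positivity) hrk
  have hMrε : M * r ≤ ε := hMr.trans (hT1.trans (min_le_left _ _))
  have hrE : r ≤ E / 2 :=
    (le_mul_of_one_le_left hr0 hM1).trans (hMr.trans (hT1.trans (min_le_right _ _)))
  set e := Real.exp (-κ * M) with he
  have he0 : 0 < e := Real.exp_pos _
  have he1 : e ≤ 1 := Real.exp_le_one_iff.2 (by nlinarith)
  -- the growing factors
  set Ap := outPlus E v M with hAp
  set Am := outMinus E v M with hAm
  have hApl := hpair.exp_le_norm_outPlus_v hE hM0 (hvre M).1 (hvre M).2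
  have hAml := hpair'.exp_le_norm_outPlus_v hE hM0 (by simpa using (hvre (-M)).1)
    (by rw [hpair.sol_v.neg_comp_neg.2]; exact (hvre (-M)).2)
  rw [outPlus_neg_comp_neg hpair.sol_v] at hAml
  have hne : ∀ A : ℂ, Real.exp (κ * M) ≤ cA * ‖A‖ → A ≠ 0 := by
    rintro A hA rfl
    rw [norm_zero, mul_zero] at hA
    exact absurd (Real.exp_pos (κ * M)) (not_lt.2 hA)
  have hAp0 : Ap ≠ 0 := hne Ap hApl
  have hAm0 : Am ≠ 0 := hne Am hAml
  -- the decaying factors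
  have hBp := hpair.norm_outPlus_u_le hE.le hM0
  have hBm := hpair'.norm_outPlus_u_le hE.le hM0
  rw [outPlus_comp_neg hpair.sol_u, norm_neg] at hBm
  -- The ratio B±/A± has size e^{-2κM}: one factor from the decay of Φ, one from the growth of v_η.
  have hγ : ∀ A b : ℂ, Real.exp (κ * M) ≤ cA * ‖A‖ → ‖b‖ ≤ (1 + Real.sqrt E) * B * e →
      ‖b‖ ≤ γ₀ * e ^ 2 * ‖A‖ := by
    intro A b hA hb
    have h1 : e ≤ e ^ 2 * (cA * ‖A‖) := by
      have : e = e ^ 2 * Real.exp (κ * M) := by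
        rw [he, sq, mul_assoc, ← Real.exp_add (-κ * M) (κ * M), show -κ * M + κ * M = 0 by ring,
          Real.exp_zero, mul_one]
      nth_rewrite 1 [this]
      gcongr
    calc _ ≤ (1 + Real.sqrt E) * B * e := hb
      _ ≤ (1 + Real.sqrt E) * B * (e ^ 2 * (cA * ‖A‖)) := by gcongr
      _ = _ := by rw [hγ₀]; ring
  -- the integrals
  set Ip := ∫ t in (0 : ℝ)..M, Φ t ^ 2 with hIp
  set Im := ∫ t in (-M)..0, Φ t ^ 2 with hIm
  have hcont : Continuous fun t => Φ t ^ 2 := hpair.sol_u.continuous.pow 2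
  have hIsum : Im + Ip = ∫ t in (-M)..M, Φ t ^ 2 :=
    intervalIntegral.integral_add_adjacent_intervals (hcont.intervalIntegrable _ _)
      (hcont.intervalIntegrable _ _)
  have hIc : c ≤ ‖Im + Ip‖ := by rw [hIsum]; exact hcI M hM1
  have hI0 : Im + Ip ≠ 0 := norm_pos_iff.1 (hc.trans_le hIc)
  have hIpb : ‖Ip‖ ≤ B ^ 2 / κ := hpair.norm_integral_sq_le hM0
  have hImb : ‖Im‖ ≤ B ^ 2 / κ := by
    have := hpair'.norm_integral_sq_le hM0
    rwa [intervalIntegral.integral_comp_neg fun t => Φ t ^ 2, neg_zero] at this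
  have hΘη : Theta V Φ M (etaVec Φ E) = (outPlus E Φ M, outMinus E Φ M) := by
    rw [Theta, hη]
    rfl
  have hXe : M * e ^ 2 ≤ M ^ 2 * e := by
    have : M * e * e ≤ M * e * M := mul_le_mul_of_nonneg_left (he1.trans hM1) (by positivity)
    linarith
  -- Here k ≤ κ enters: one factor e is at most e^{-kM}, the other beats M². Hence the Newton step
  -- fits inside Ω_M.
  have hX0 : e ^ 2 * M ^ 2 ≤ M ^ 2 * e * Real.exp (-(k * M)) := by
    have : e ≤ Real.exp (-(k * M)) := Real.exp_le_exp.2 (by nlinarith)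
    calc e ^ 2 * M ^ 2 = M ^ 2 * e * e := by ring
      _ ≤ _ := by gcongr
  obtain ⟨⟨ws, zs⟩, hmem, hroot, huniq, hdist, happ⟩ := exists_zero_of_approx_affine
    (T := Theta V Φ M) (η := etaVec Φ E) (Ω := OmegaBall Φ E k M) (K := K)
    (q := C * (M * (e ^ 2 + r))) (γ := γ₀ * e ^ 2) (r := r) hAp0 hAm0 hI0 hK0
    (norm_linearizedInverse_le hc hIc hIpb hImb) (isClosed_omegaBall Φ E k M)
    (fun x hx => mem_omegaBall_of_norm_le hx) (fun x hx => norm_le_of_mem_omegaBall hx)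
    (fun x hx y hy => (hlip M r hM1 hr0 hMrε x y (norm_le_of_mem_omegaBall hx)
      (norm_le_of_mem_omegaBall hy)).1)
    (fun x hx y hy => (hlip M r hM1 hr0 hMrε x y (norm_le_of_mem_omegaBall hx)
      (norm_le_of_mem_omegaBall hy)).2)
    (by
      refine le_trans ?_ hT2
      rw [← mul_assoc]
      refine mul_le_mul_of_nonneg_left ?_ (by positivity)
      rw [mul_add]
      exact add_le_add hXe hMr)
    (by rw [hΘη]; exact hγ _ _ hApl hBp) (by rw [hΘη]; exact hγ _ _ hAml hBm)
    (by
      have h1 : K * (γ₀ * e ^ 2) * M ^ 2 ≤ 1 / 4 * Real.exp (-(k * M)) := by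
        calc _ = K * γ₀ * (e ^ 2 * M ^ 2) := by ring
          _ ≤ K * γ₀ * (M ^ 2 * e * Real.exp (-(k * M))) := by gcongr
          _ = K * γ₀ * (M ^ 2 * e) * Real.exp (-(k * M)) := by ring
          _ ≤ _ := by gcongr
      have h2 : r / 4 = 1 / 4 * Real.exp (-(k * M)) / M ^ 2 := by rw [hr]; ring
      rw [h2, le_div_iff₀ (by positivity)]
      exact h1)
  have hr' := norm_le_of_mem_omegaBall hmem
  -- The Lipschitz estimate is applied again with the actual distance d = O(e^{-2κM}) in place of r,
  -- which turns the remainder into O(M(e^{-2κM} + d)d) = O(M e^{-4κM}).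
  set d := ‖((ws, zs) : ℂ × ℂ) - etaVec Φ E‖ with hd
  have hd0 : 0 ≤ d := norm_nonneg _
  have hMd : M * d ≤ ε := le_trans (by gcongr) hMrε
  have hl := hlip M d hM1 hd0 hMd (ws, zs) (etaVec Φ E) le_rfl (by rw [sub_self, norm_zero]; exact hd0)
  have happ' := happ _ hl.1 hl.2
  have he4 : e ^ 4 = Real.exp (-(4 * κ * M)) := by
    rw [he, ← Real.exp_nat_mul]
    congr 1
    push_cast
    ring
  have hrem : K * (C * (M * (e ^ 2 + d)) * d) ≤ C' * (M * Real.exp (-(4 * κ * M))) := by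
    have hd' : d ≤ 2 * (K * γ₀) * e ^ 2 := by linarith
    calc K * (C * (M * (e ^ 2 + d)) * d)
        ≤ K * (C * (M * (e ^ 2 + 2 * (K * γ₀) * e ^ 2)) * (2 * (K * γ₀) * e ^ 2)) := by gcongr
      _ = C' * (M * e ^ 4) := by rw [hC']; ring
      _ = _ := by rw [he4]
  have hsplit : uSqInt V Φ E (-M) M = Im + Ip := by rw [uSqInt, hη, hIsum]
  have hden0 : corrDenom V Φ E M ≠ 0 := by
    rw [corrDenom, hsplit]
    exact mul_ne_zero (mul_ne_zero hI0 hAp0) hAm0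
  have hwz := happ'.trans hrem
  rw [← approx_eq hη hAp0 hAm0 hsplit hI0] at hwz
  have hw : ‖ws - wApprox V Φ E M‖ ≤ C' * (M * Real.exp (-(4 * κ * M))) :=
    (norm_fst_le ((ws, zs) - (wApprox V Φ E M, zApprox V Φ E M))).trans hwz
  have hz : ‖zs - zApprox V Φ E M‖ ≤ C' * (M * Real.exp (-(4 * κ * M))) :=
    (norm_snd_le ((ws, zs) - (wApprox V Φ E M, zApprox V Φ E M))).trans hwz
  have hzre : 0 < zs.re := by
    have h1 : ‖zs - (E : ℂ)‖ ≤ E / 2 :=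
      (norm_snd_le (((ws, zs) : ℂ × ℂ) - etaVec Φ E)).trans (hr'.trans hrE)
    have h2 := (Complex.abs_re_le_norm (zs - E)).trans h1
    rw [Complex.sub_re, Complex.ofReal_re, abs_le] at h2
    linarith [h2.1]
  have hbig : C' * (M * Real.exp (-(4 * κ * M)))
      ≤ (C' + C' * |1 / (4 * (κ - k))| + 1) * (M * Real.exp (-(4 * κ * M))) :=
    mul_le_mul_of_nonneg_right (by linarith) (by positivity)
  have hbig' : k < κ → C' * (M * Real.exp (-(4 * κ * M)))
      ≤ (C' + C' * |1 / (4 * (κ - k))| + 1) * Real.exp (-(4 * k * M)) := fun hlt =>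
    calc _ ≤ C' * (1 / (4 * (κ - k)) * Real.exp (-(4 * k * M))) :=
          mul_le_mul_of_nonneg_left (mul_exp_le_mul_exp hlt) hC'0
      _ ≤ C' * (|1 / (4 * (κ - k))| * Real.exp (-(4 * k * M))) := by
          gcongr
          exact le_abs_self _
      _ = C' * |1 / (4 * (κ - k))| * Real.exp (-(4 * k * M)) := by ring
      _ ≤ _ := mul_le_mul_of_nonneg_right (by linarith) (Real.exp_pos _).le
  exact ⟨hden0, ws, zs, hmem, hroot, huniq,
    isResonance_of_outgoing hV hb hMpos (hu (ws, zs)).1 (hu (ws, zs)).2.2 hzre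
      (congrArg Prod.fst hroot) (congrArg Prod.snd hroot),
    hw.trans hbig, hz.trans hbig, fun hlt => ⟨hw.trans (hbig' hlt), hz.trans (hbig' hlt)⟩⟩
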